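/- For complex $s$ with $\operatorname{Re}s>1$ let $$M(s)=\sum_{n=1}^\infty \frac{e^{-n}}{n^s}\left(1+n+\frac{n^2}{2!}+\dots+\frac{n^n}{n!}\right),$$ and for $s\in\mathbb{C}$ let $A_k(s)$ be the coefficients of the Taylor expansion at $t=0$ $$\left[\frac{-t-\ln(1-t)}{t^2/2}\right]^s=\left[1+\frac{2t}{3}+\frac{2t^2}{4}+\frac{2t^3}{5}+\dots\right]^s=\sum_{k=0}^\infty A_k(s)\,t^k$$ (the branch of the power that equals $1$ at $t=0$). Then $M$ has a meromorphic continuation to $\mathbb{C}$, again denoted by $M$, which is holomorphic outside the points $1,\tfrac12,-\tfrac12,-\tfrac32,\dots$, and the following holds. 0) $M(0)=A_2'(0)-A_0(0)=-\dfrac{13}{18}$. 1) $M(-N)=(-1)^{N-1}\,2^N\,(N-1)!\,A_{2N+2}(-N)$ for every integer $N>0$. 2) For every integer $N\ge 0$, $$\lim_{s\to -N} M\!\left(s+\tfrac12\right)(s+N)=(-1)^{N-1}\,\frac{(2N)!}{2^N N!}\,\frac{A_{2N+1}\!\left(\tfrac12-N\right)}{2N-1}\,\sqrt{\frac{2}{\pi}}.$$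 -/

import Mathlib

open Filter Topology

namespace BinomialType

noncomputable section

/-- The `n`-th term `e^{-n} n^{-s} (1 + n + n^2/2! + ... + n^n/n!)` of the Dirichlet series of `M`,
meant for `n ≥ 1`. -/
def seriesTerm (s : ℂ) (n : ℕ) : ℂ :=
  Complex.exp (-(n : ℂ)) / (n : ℂ) ^ s *
    ∑ k ∈ Finset.range (n + 1), (n : ℂ) ^ k / (k.factorial : ℂ)

/-- The points `1, 1/2, -1/2, -3/2, ...`, off which the continuation of `M` is holomorphic. -/
def singularPoints : Set ℂ :=
  {1} ∪ Set.range (fun N : ℕ => (1 / 2 : ℂ) - (N : ℂ))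

/-- `M` is the analytic continuation of the function `∑_{n ≥ 1} seriesTerm s n`, `Re s > 1`:
it is meromorphic on `ℂ`, and holomorphic off `singularPoints`, where its values are therefore
determined by those on the half-plane `Re s > 1`. -/
structure IsContinuation (M : ℂ → ℂ) : Prop where
  hasSum : ∀ s : ℂ, 1 < s.re → HasSum (fun n : ℕ => seriesTerm s (n + 1)) (M s)
  meromorphic : MeromorphicOn M Set.univ
  holomorphic : DifferentiableOn ℂ M singularPointsᶜ

/-- The function `(-t - ln(1 - t)) / (t^2/2) = 1 + 2t/3 + 2t^2/4 + ...`, with the removable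
singularity at `t = 0` filled in by the value `1`. -/
def base (t : ℂ) : ℂ :=
  if t = 0 then 1 else (-t - Complex.log (1 - t)) / (t ^ 2 / 2)

/-- `A k s` is the coefficient of `t^k` in the Taylor expansion at `t = 0` of
`((-t - ln(1 - t)) / (t^2/2))^s` (principal branch; the base is `1` at `t = 0`). -/
def A (k : ℕ) (s : ℂ) : ℂ :=
  iteratedDeriv k (fun t : ℂ => base t ^ s) 0 / (k.factorial : ℂ)

end

end BinomialType

namespace BinomialType

open MeasureTheory

/-! Write `p n` for the Poisson probability `poissonCdf n`. For `Re s > 1`, `Γ(s) M(s)` is the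
Mellin transform of `∑_{n ≥ 1} p n e^{-ny}`. Everything rests on a closed form of the generating
function: `∑_{n ≥ 0} p n x^n = 1/(1 - T)²` at `x = T e^{1-T}` (`cdfGenFun_mul_exp`). With `τ = 1 -
T`, the relation `x = e^{-y}` reads `y = -τ - ln(1 - τ) = (τ²/2) · base τ`, and the exponential
series becomes `1/τ² - 1`.

Only small `y` obstructs continuation: the Mellin integral away from zero is entire. Near zero,
changing variables to `τ` and integrating by parts (`integral_expSeries_eq`) leaves `2^{1-s} ∫
τ^{2s-3} (base τ)^s dτ`. Expanding the power by the `A k s` and integrating termwise gives simple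
poles at `s = 1 - k/2`, with polar parts proportional to `A k`.

The prefactor is `1/Γ(s+1)`. Its zeros at `-1, -2, ...` cancel the poles with `k = 2N + 2`, `N > 0`,
and yield `M(-N)`; at `s = 0` the pole `k = 2` is cancelled by `A 2 0 = 0`. The pole `k = 0` and
those with odd `k` remain, and the latter give the residues. Any other continuation agrees off the
singular points by the identity theorem. -/

/-! ### Power series with bounded coefficients -/

/-- A power series with bounded coefficients converges on the unit ball. -/
theorem hasFPowerSeriesOnBall_ofScalars {𝕜 : Type*} [RCLike 𝕜] {c : ℕ → 𝕜} {C : ℝ} {f : 𝕜 → 𝕜}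
    (hc : ∀ n, ‖c n‖ ≤ C) (hf : ∀ x, ‖x‖ < 1 → HasSum (fun n => c n * x ^ n) (f x)) :
    HasFPowerSeriesOnBall f (FormalMultilinearSeries.ofScalars 𝕜 c) 0 1 where
  r_le := by
    have := FormalMultilinearSeries.le_radius_of_bound
      (FormalMultilinearSeries.ofScalars 𝕜 c) C (r := 1) fun n => by
        simpa [FormalMultilinearSeries.ofScalars_norm] using hc n
    simpa using this
  r_pos := one_pos
  hasSum := by
    intro y hy
    have hy' : ‖y‖ < 1 := by
      rw [← ENNReal.ofReal_one, Metric.eball_ofReal] at hy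
      simpa using hy
    simpa [FormalMultilinearSeries.ofScalars_apply_eq, smul_eq_mul, mul_comm] using hf y hy'

theorem iteratedDeriv_zero_of_hasSum {𝕜 : Type*} [RCLike 𝕜] {c : ℕ → 𝕜} {C : ℝ} {f : 𝕜 → 𝕜}
    (hc : ∀ n, ‖c n‖ ≤ C) (hf : ∀ x, ‖x‖ < 1 → HasSum (fun n => c n * x ^ n) (f x)) (k : ℕ) :
    iteratedDeriv k f 0 = k.factorial * c k := by
  have h := (hasFPowerSeriesOnBall_ofScalars hc hf).factorial_smul 1 k
  rw [iteratedDeriv_eq_iteratedFDeriv, ← h]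
  simp

theorem analyticAt_of_hasSum {𝕜 : Type*} [RCLike 𝕜] {c : ℕ → 𝕜} {C : ℝ} {f : 𝕜 → 𝕜}
    (hc : ∀ n, ‖c n‖ ≤ C) (hf : ∀ x, ‖x‖ < 1 → HasSum (fun n => c n * x ^ n) (f x)) {x : 𝕜}
    (hx : ‖x‖ < 1) : AnalyticAt 𝕜 f x := by
  refine (hasFPowerSeriesOnBall_ofScalars hc hf).analyticAt_of_mem ?_
  rw [← ENNReal.ofReal_one, Metric.eball_ofReal]
  simpa using hx

/-! ### Poisson probabilities and their generating function -/

/-- The truncated exponential series `1 + n + ... + n^n/n!`. -/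
noncomputable def truncExp (n : ℕ) : ℝ :=
  ∑ k ∈ Finset.range (n + 1), (n : ℝ) ^ k / (k.factorial : ℝ)

/-- The probability `e^{-n} (1 + n + ... + n^n/n!)` that a Poisson variable of mean `n` is at
most `n`. -/
noncomputable def poissonCdf (n : ℕ) : ℝ := Real.exp (-n) * truncExp n

theorem truncExp_nonneg (n : ℕ) : 0 ≤ truncExp n :=
  Finset.sum_nonneg fun _ _ => by positivity

theorem truncExp_le (n : ℕ) : truncExp n ≤ Real.exp n :=
  Real.sum_le_exp_of_nonneg n.cast_nonneg _

theorem poissonCdf_nonneg (n : ℕ) : 0 ≤ poissonCdf n :=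
  mul_nonneg (Real.exp_pos _).le (truncExp_nonneg n)

theorem poissonCdf_le_one (n : ℕ) : poissonCdf n ≤ 1 := by
  calc poissonCdf n ≤ Real.exp (-n) * Real.exp n :=
        mul_le_mul_of_nonneg_left (truncExp_le n) (Real.exp_pos _).le
    _ = 1 := by rw [← Real.exp_add]; simp

theorem norm_poissonCdf_le_one (n : ℕ) : ‖poissonCdf n‖ ≤ 1 := by
  rw [Real.norm_of_nonneg (poissonCdf_nonneg n)]
  exact poissonCdf_le_one n

theorem poissonCdf_zero : poissonCdf 0 = 1 := by simp [poissonCdf, truncExp]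

theorem seriesTerm_eq (s : ℂ) (n : ℕ) : seriesTerm s n = poissonCdf n / (n : ℂ) ^ s := by
  simp only [seriesTerm, poissonCdf, truncExp]
  push_cast
  ring

/-- The `r`-th finite difference of `x ^ r`, divided by `r!`. -/
theorem sum_neg_one_pow_mul_pow (y : ℝ) (r : ℕ) :
    ∑ j ∈ Finset.range (r + 1), (-1 : ℝ) ^ j * (y - j) ^ r / (j.factorial * (r - j).factorial) = 1 := by
  -- The base point `y - r`, combined with reversing the sum, turns the shifted arguments into `y -
  -- j`.
  have h := congrFun (fwdDiff_iter_eq_factorial (R := ℝ) (n := r)) (y - r)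
  rw [fwdDiff_iter_eq_sum_shift, ← Finset.sum_range_reflect] at h
  have hr : (r.factorial : ℝ) ≠ 0 := by positivity
  rw [Pi.natCast_apply] at h
  rw [← mul_right_inj' hr, mul_one, Finset.mul_sum]
  refine Eq.trans ?_ h
  refine Finset.sum_congr rfl fun j hj => ?_
  have hj' : j ≤ r := by simpa [Nat.lt_succ_iff] using hj
  have e1 : r + 1 - 1 - j = r - j := by omega
  have e2 : r - (r - j) = j := by omega
  rw [e1, e2, Nat.choose_symm hj', zsmul_eq_mul, nsmul_one, Nat.cast_sub hj']
  push_cast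
  rw [Nat.cast_choose ℝ hj', show y - r + ((r : ℝ) - j) = y - j by ring]
  ring

/-- This is the coefficient of `T^m` in `∑ truncExp n T^n e^{-nT}`. Collecting the double sum by the
total exponent `r = j + k` gives `m + 1` normalized finite differences, each equal to 1. -/
theorem sum_antidiagonal_truncExp (m : ℕ) :
    ∑ p ∈ Finset.HasAntidiagonal.antidiagonal m, truncExp p.1 * ((-(p.1 : ℝ)) ^ p.2 / (p.2.factorial : ℝ)) = m + 1 := by
  have h : ∑ r ∈ Finset.range (m + 1), ∑ j ∈ Finset.range (r + 1),
      (-1 : ℝ) ^ j * ((m : ℝ) - j) ^ r / (j.factorial * (r - j).factorial) = m + 1 := by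
    rw [Finset.sum_congr rfl fun r _ => sum_neg_one_pow_mul_pow (m : ℝ) r]
    simp
  rw [← h, ← Finset.Nat.sum_antidiagonal_swap, Finset.Nat.sum_antidiagonal_eq_sum_range_succ_mk]
  simp only [Prod.swap, truncExp, Finset.sum_mul]
  rw [Finset.sum_sigma', Finset.sum_sigma']
  refine Finset.sum_nbij' (fun x => ⟨x.1 + x.2, x.1⟩) (fun x => ⟨x.2, x.1 - x.2⟩) ?_ ?_ ?_ ?_ ?_
  · simp only [Finset.mem_sigma, Finset.mem_range]; intros; omega
  · simp only [Finset.mem_sigma, Finset.mem_range]; intros; omega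
  · rintro ⟨a, b⟩ hx; simp
  · rintro ⟨a, b⟩ hx
    simp only [Finset.mem_sigma, Finset.mem_range] at hx
    have : b + (a - b) = a := by omega
    simp [this]
  · rintro ⟨j, k⟩ hx
    simp only [Finset.mem_sigma, Finset.mem_range] at hx
    have hj : j ≤ m := by omega
    simp only [Nat.add_sub_cancel_left]
    rw [Nat.cast_sub hj, neg_pow, pow_add]
    ring

/-- The generating function `∑ poissonCdf n * x ^ n`. -/
noncomputable def cdfGenFun (x : ℝ) : ℝ := ∑' n, poissonCdf n * x ^ n

theorem summable_poissonCdf_mul_pow {x : ℝ} (hx : ‖x‖ < 1) :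
    Summable fun n => ‖poissonCdf n * x ^ n‖ := by
  refine Summable.of_nonneg_of_le (fun _ => norm_nonneg _) (fun n => ?_)
    (summable_geometric_of_lt_one (norm_nonneg x) hx)
  rw [norm_mul, norm_pow]
  exact mul_le_of_le_one_left (by positivity) (norm_poissonCdf_le_one n)

theorem hasSum_cdfGenFun {x : ℝ} (hx : ‖x‖ < 1) :
    HasSum (fun n => poissonCdf n * x ^ n) (cdfGenFun x) :=
  (summable_poissonCdf_mul_pow hx).of_norm.hasSum

theorem analyticAt_cdfGenFun {x : ℝ} (hx : ‖x‖ < 1) : AnalyticAt ℝ cdfGenFun x :=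
  analyticAt_of_hasSum norm_poissonCdf_le_one (fun _ => hasSum_cdfGenFun) hx

/-- `T * exp (1 - T)` lies in the unit interval for `T` in a neighbourhood of `[0, 1)`. -/
theorem norm_mul_exp_one_sub_lt_one {T : ℝ} (h0 : -(1 / 10) < T) (h1 : T < 1) :
    ‖T * Real.exp (1 - T)‖ < 1 := by
  have key : |T| < Real.exp (T - 1) := by
    rcases le_or_gt 0 T with h | h
    · rw [abs_of_nonneg h]
      have := Real.add_one_lt_exp (x := T - 1) (by linarith)
      linarith
    · rw [abs_of_neg h]
      -- For negative `T` in the range, `|T| < 1/10 < e^{-2} ≤ e^{T-1}`.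
      have h2 : Real.exp 2 < 10 := by
        have h3 := Real.exp_one_lt_d9
        have : Real.exp 2 = Real.exp 1 * Real.exp 1 := by rw [← Real.exp_add]; norm_num
        rw [this]
        nlinarith [Real.exp_pos 1]
      have h4 : (1 / 10 : ℝ) < Real.exp (-2) := by
        rw [Real.exp_neg, ← one_div]
        exact one_div_lt_one_div_of_lt (Real.exp_pos _) h2
      have : Real.exp (-2) ≤ Real.exp (T - 1) := Real.exp_le_exp.mpr (by linarith)
      linarith
  rw [norm_mul, Real.norm_eq_abs, Real.norm_of_nonneg (Real.exp_pos _).le]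
  calc |T| * Real.exp (1 - T) < Real.exp (T - 1) * Real.exp (1 - T) := by
        gcongr
    _ = 1 := by rw [← Real.exp_add]; simp

theorem poissonCdf_mul_pow (T : ℝ) (n : ℕ) :
    poissonCdf n * (T * Real.exp (1 - T)) ^ n = truncExp n * T ^ n * Real.exp (-n * T) := by
  rw [mul_pow, ← Real.exp_nat_mul, poissonCdf]
  have : Real.exp (-n * T) = Real.exp (-n) * Real.exp (n * (1 - T)) := by
    rw [← Real.exp_add]; ring_nf
  rw [this]
  ring

theorem hasSum_pow_div_factorial (x : ℝ) :
    HasSum (fun j : ℕ => x ^ j / (j.factorial : ℝ)) (Real.exp x) := by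
  rw [Real.exp_eq_exp_ℝ]
  exact NormedSpace.expSeries_div_hasSum_exp x

/-- Expanding `e^{-nT}` gives a double series which, for small `T`, converges absolutely and may be
summed along diagonals; the `m`-th diagonal contributes `(m + 1) T^m`. -/
theorem cdfGenFun_mul_exp_of_small {T : ℝ} (hT : |T| < 1 / 10) :
    cdfGenFun (T * Real.exp (1 - T)) = 1 / (1 - T) ^ 2 := by
  set u : ℕ × ℕ → ℝ := fun p =>
    truncExp p.1 * T ^ p.1 * ((-p.1 * T) ^ p.2 / (p.2.factorial : ℝ)) with hu
  have habs : -(1 / 10) < T ∧ T < 1 / 10 := abs_lt.mp hT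
  have hinner : ∀ n, HasSum (fun j => u (n, j)) (poissonCdf n * (T * Real.exp (1 - T)) ^ n) := by
    intro n
    rw [poissonCdf_mul_pow]
    exact (hasSum_pow_div_factorial (-n * T)).mul_left _
  have hnorm : ∀ n, HasSum (fun j => ‖u (n, j)‖) (truncExp n * |T| ^ n * Real.exp (n * |T|)) := by
    intro n
    refine ((hasSum_pow_div_factorial (n * |T|)).mul_left (truncExp n * |T| ^ n)).congr_fun
      fun j => ?_
    simp [hu, abs_of_nonneg (truncExp_nonneg n)]
  have hsum : Summable u := by
    refine Summable.of_norm ?_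
    rw [summable_prod_of_nonneg fun _ => norm_nonneg _]
    refine ⟨fun n => (hnorm n).summable, ?_⟩
    rw [funext fun n => (hnorm n).tsum_eq]
    -- This is the ratio of the dominating geometric series; it is below 1 because `|T| < 1/10` and
    -- `e² < 10`.
    have hq : |T| * Real.exp (1 + |T|) < 1 := by
      have h3 := Real.exp_one_lt_d9
      have : Real.exp (1 + |T|) ≤ Real.exp 2 := Real.exp_le_exp.mpr (by linarith)
      have h4 : Real.exp 2 = Real.exp 1 * Real.exp 1 := by rw [← Real.exp_add]; norm_num
      nlinarith [Real.exp_pos 1, abs_nonneg T]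
    refine Summable.of_nonneg_of_le (fun n => ?_) (fun n => ?_)
      (summable_geometric_of_lt_one (by positivity) hq)
    · have := truncExp_nonneg n
      positivity
    · calc truncExp n * |T| ^ n * Real.exp (n * |T|)
          ≤ Real.exp n * |T| ^ n * Real.exp (n * |T|) := by gcongr; exact truncExp_le n
        _ = (|T| * Real.exp (1 + |T|)) ^ n := by
          rw [mul_pow, ← Real.exp_nat_mul, mul_add, Real.exp_add, mul_one]; ring
  have h1 : HasSum u (cdfGenFun (T * Real.exp (1 - T))) := by
    have h2 := hsum.hasSum.prod_fiberwise hinner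
    rw [cdfGenFun, h2.tsum_eq]
    exact hsum.hasSum
  have h2 : HasSum (fun m : ℕ => ((m : ℝ) + 1) * T ^ m) (cdfGenFun (T * Real.exp (1 - T))) := by
    have h3 := (Finset.HasAntidiagonal.sigmaAntidiagonalEquivProd (A := ℕ)).hasSum_iff.mpr h1
    convert h3.sigma (fun m => hasSum_fintype _) using 2 with m
    rw [← sum_antidiagonal_truncExp, Finset.sum_mul, ← Finset.sum_coe_sort]
    refine Finset.sum_congr rfl fun p _ => ?_
    have hp : (p : ℕ × ℕ).1 + (p : ℕ × ℕ).2 = m := Finset.HasAntidiagonal.mem_antidiagonal.mp p.2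
    simp only [hu, Function.comp_apply, Finset.HasAntidiagonal.sigmaAntidiagonalEquivProd_apply]
    have hT' : T ^ m = T ^ (p : ℕ × ℕ).1 * T ^ (p : ℕ × ℕ).2 := by rw [← pow_add, hp]
    rw [hT', mul_pow]
    ring
  have h3 := tsum_choose_mul_geometric_of_norm_lt_one (𝕜 := ℝ) 1 (r := T)
    (by rw [Real.norm_eq_abs]; linarith)
  rw [← h2.tsum_eq]
  simpa using h3

/-- The double series no longer converges absolutely for `T` near 1, so the identity is propagated
from small `T` by real analyticity. The interval reaches below 0 so that 0 is an interior point. -/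
theorem cdfGenFun_mul_exp {T : ℝ} (h0 : 0 < T) (h1 : T < 1) :
    cdfGenFun (T * Real.exp (1 - T)) = 1 / (1 - T) ^ 2 := by
  have hf : AnalyticOnNhd ℝ (fun T => cdfGenFun (T * Real.exp (1 - T))) (Set.Ioo (-(1 / 10)) 1) := by
    intro x hx
    refine AnalyticAt.fun_comp (analyticAt_cdfGenFun (norm_mul_exp_one_sub_lt_one hx.1 hx.2)) ?_
    fun_prop
  have hg : AnalyticOnNhd ℝ (fun T : ℝ => 1 / (1 - T) ^ 2) (Set.Ioo (-(1 / 10)) 1) := by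
    intro x hx
    have : (1 - x) ^ 2 ≠ 0 := pow_ne_zero _ (by linarith [hx.2])
    fun_prop (disch := assumption)
  refine hf.eqOn_of_preconnected_of_eventuallyEq hg isPreconnected_Ioo (z₀ := 0) (by norm_num) ?_
    ⟨by linarith, h1⟩
  filter_upwards [Metric.ball_mem_nhds (0 : ℝ) (by norm_num : (0 : ℝ) < 1 / 10)] with x hx
  exact cdfGenFun_mul_exp_of_small (by simpa using hx)

/-! ### The power of `base` and its Taylor coefficients -/

theorem hasSum_base {t : ℂ} (ht : ‖t‖ < 1) :
    HasSum (fun k : ℕ => (2 / (k + 2) : ℂ) * t ^ k) (base t) := by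
  rcases eq_or_ne t 0 with rfl | h0
  · simp only [base, if_true]
    convert hasSum_single (α := ℂ) (f := fun k : ℕ => (2 / (k + 2) : ℂ) * 0 ^ k) 0 ?_ using 1
    · simp
    · intro k hk
      simp [hk]
  · have h := Complex.hasSum_taylorSeries_neg_log ht
    rw [← hasSum_nat_add_iff' 2] at h
    have h2 := h.mul_right (2 / t ^ 2)
    simp only [base, if_neg h0]
    have e : (-t - Complex.log (1 - t)) / (t ^ 2 / 2) =
        (-Complex.log (1 - t) - ∑ i ∈ Finset.range 2, t ^ i / (i : ℂ)) * (2 / t ^ 2) := by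
      simp [Finset.sum_range_succ]
      field_simp
      ring
    rw [e]
    refine h2.congr_fun fun k => ?_
    have : (k : ℂ) + 2 ≠ 0 := by exact_mod_cast (by omega : k + 2 ≠ 0)
    push_cast
    field_simp
    ring

theorem norm_base_coeff_le (k : ℕ) : ‖(2 / (k + 2) : ℂ)‖ ≤ 1 := by
  have : ‖(k : ℂ) + 2‖ = k + 2 := by
    rw [show (k : ℂ) + 2 = ((k + 2 : ℕ) : ℂ) by push_cast; ring, Complex.norm_natCast]
    push_cast; ring
  rw [norm_div, this, div_le_one (by positivity)]
  simp

theorem analyticAt_base {t : ℂ} (ht : ‖t‖ < 1) : AnalyticAt ℂ base t :=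
  analyticAt_of_hasSum norm_base_coeff_le (fun _ => hasSum_base) ht

theorem base_zero : base 0 = 1 := by simp [base]

/-- Comparison with a geometric series bounds the norm by `(2/3)|t|/(1 - |t|)`, which is below 1
exactly when `|t| < 3/5`. On this disc `base` stays in the right half-plane, so its principal powers
are analytic. -/
theorem norm_base_sub_one_lt {t : ℂ} (ht : ‖t‖ < 3 / 5) : ‖base t - 1‖ < 1 := by
  have h := hasSum_base (ht.trans (by norm_num))
  rw [← hasSum_nat_add_iff' 1] at h
  have hg : HasSum (fun k : ℕ => 2 / 3 * ‖t‖ * ‖t‖ ^ k) (2 / 3 * ‖t‖ * (1 - ‖t‖)⁻¹) :=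
    (hasSum_geometric_of_lt_one (norm_nonneg t) (by linarith)).mul_left _
  have hle : ‖base t - 1‖ ≤ 2 / 3 * ‖t‖ * (1 - ‖t‖)⁻¹ := by
    have := h.norm_le_of_bounded hg fun k => ?_
    · simpa using this
    · have e : ‖(((k + 1 : ℕ) : ℂ)) + 2‖ = k + 3 := by
        rw [show (((k + 1 : ℕ) : ℂ)) + 2 = ((k + 3 : ℕ) : ℂ) by push_cast; ring,
          Complex.norm_natCast]
        push_cast; ring
      rw [norm_mul, norm_div, e, norm_pow, pow_succ', Complex.norm_ofNat, ← mul_assoc]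
      gcongr
      linarith [(k.cast_nonneg : (0 : ℝ) ≤ k)]
  refine hle.trans_lt ?_
  have : 0 < 1 - ‖t‖ := by linarith
  rw [← div_eq_mul_inv, div_lt_one this]
  linarith

theorem base_mem_slitPlane {t : ℂ} (ht : ‖t‖ < 3 / 5) : base t ∈ Complex.slitPlane := by
  left
  have h1 := (Complex.abs_re_le_norm (base t - 1)).trans_lt (norm_base_sub_one_lt ht)
  rw [Complex.sub_re, Complex.one_re, abs_lt] at h1
  linarith [h1.1]

theorem base_ne_zero {t : ℂ} (ht : ‖t‖ < 3 / 5) : base t ≠ 0 :=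
  Complex.slitPlane_ne_zero (base_mem_slitPlane ht)

theorem analyticAt_base_cpow (s : ℂ) {t : ℂ} (ht : ‖t‖ < 3 / 5) :
    AnalyticAt ℂ (fun t => base t ^ s) t :=
  (analyticAt_base (ht.trans (by norm_num))).cpow analyticAt_const (base_mem_slitPlane ht)

theorem exists_norm_base_cpow_le :
    ∃ Λ : ℝ, 0 ≤ Λ ∧ ∀ s t : ℂ, ‖t‖ ≤ 1 / 2 → ‖base t ^ s‖ ≤ Real.exp (Λ * ‖s‖) := by
  have hc : ContinuousOn (fun t => Complex.log (base t)) (Metric.closedBall 0 (1 / 2)) := by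
    intro t ht
    have ht' : ‖t‖ < 3 / 5 := by
      have : ‖t‖ ≤ 1 / 2 := by simpa using ht
      linarith
    exact ((analyticAt_base (ht'.trans (by norm_num))).clog
      (base_mem_slitPlane ht')).continuousAt.continuousWithinAt
  obtain ⟨C, hC⟩ := (isCompact_closedBall (0 : ℂ) (1 / 2)).exists_bound_of_continuousOn hc
  refine ⟨C, (norm_nonneg _).trans (hC 0 (by simp)), fun s t ht => ?_⟩
  rw [Complex.cpow_def_of_ne_zero (base_ne_zero (by linarith)), Complex.norm_exp]
  refine Real.exp_le_exp.mpr ((Complex.re_le_norm _).trans ?_)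
  rw [norm_mul]
  gcongr
  exact hC t (by simpa using ht)

/-- Cauchy's estimate on the circle `|t| = 1/2`. The bound is locally uniform in `s`, and its growth
`2^k` is beaten by `(1/4)^k` at the cutoff `τ = 1/4` used later. -/
theorem exists_norm_A_le :
    ∃ Λ : ℝ, 0 ≤ Λ ∧ ∀ k s, ‖A k s‖ ≤ Real.exp (Λ * ‖s‖) * 2 ^ k := by
  obtain ⟨Λ, h0, hΛ⟩ := exists_norm_base_cpow_le
  refine ⟨Λ, h0, fun k s => ?_⟩
  have hd : DifferentiableOn ℂ (fun t => base t ^ s) (Metric.closedBall 0 (1 / 2)) := by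
    intro t ht
    have : ‖t‖ ≤ 1 / 2 := by simpa using ht
    exact (analyticAt_base_cpow s (by linarith)).differentiableAt.differentiableWithinAt
  have h := Complex.norm_iteratedDeriv_le_of_forall_mem_sphere_norm_le (c := 0) (R := 1 / 2) k
    (by norm_num) ((hd.mono Metric.closure_ball_subset_closedBall).diffContOnCl)
    (fun t ht => hΛ s t (by simpa using ht.le))
  have hk : (0 : ℝ) < k.factorial := by positivity
  rw [A, norm_div, Complex.norm_natCast, div_le_iff₀ hk]
  refine h.trans (le_of_eq ?_)
  rw [one_div, inv_pow, div_inv_eq_mul]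
  ring

theorem hasSum_A (s : ℂ) {t : ℂ} (ht : ‖t‖ < 3 / 5) :
    HasSum (fun k => A k s * t ^ k) (base t ^ s) := by
  have h := Complex.hasSum_taylorSeries_on_ball (c := 0) (r := 3 / 5) (z := t)
    (f := fun t => base t ^ s)
    (fun t ht => (analyticAt_base_cpow s
      (by simpa using ht)).differentiableAt.differentiableWithinAt) (by simpa using ht)
  refine h.congr_fun fun k => ?_
  simp only [A, sub_zero, smul_eq_mul]
  ring

theorem deriv_base_cpow (s : ℂ) :
    deriv (fun t => base t ^ s) =ᶠ[𝓝 0] fun t => s * (logDeriv base t * base t ^ s) := by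
  filter_upwards [Metric.ball_mem_nhds (0 : ℂ) (by norm_num : (0 : ℝ) < 3 / 5)] with t ht
  have ht' : ‖t‖ < 3 / 5 := by simpa using ht
  have h0 := base_ne_zero ht'
  have hd := (analyticAt_base (ht'.trans (by norm_num))).differentiableAt.hasDerivAt
  rw [(hd.cpow_const (base_mem_slitPlane ht')).deriv, Complex.cpow_sub _ _ h0, Complex.cpow_one,
    logDeriv_apply]
  ring

theorem analyticAt_logDeriv_base : AnalyticAt ℂ (logDeriv base) 0 :=
  (analyticAt_base (by simp)).deriv.div (analyticAt_base (by simp))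
    (base_ne_zero (by norm_num))

/-- Leibniz's rule applied to `(base^s)' = s · (base'/base) · base^s`. This recursion makes the
coefficients entire in `s` and exhibits the factor `s` in all of positive index. -/
theorem iteratedDeriv_base_cpow_succ (k : ℕ) (s : ℂ) :
    iteratedDeriv (k + 1) (fun t => base t ^ s) 0 =
      s * ∑ i ∈ Finset.range (k + 1), (k.choose i : ℂ) * iteratedDeriv i (logDeriv base) 0 *
        iteratedDeriv (k - i) (fun t => base t ^ s) 0 := by
  rw [iteratedDeriv_succ', (deriv_base_cpow s).iteratedDeriv_eq, iteratedDeriv_const_mul_field]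
  congr 1
  exact iteratedDeriv_mul analyticAt_logDeriv_base.contDiffAt
    (analyticAt_base_cpow s (by norm_num)).contDiffAt

theorem A_zero (s : ℂ) : A 0 s = 1 := by simp [A, base_zero]

theorem A_succ_zero (k : ℕ) : A (k + 1) 0 = 0 := by
  rw [A, iteratedDeriv_base_cpow_succ]
  simp

theorem differentiable_A (k : ℕ) : Differentiable ℂ (A k) := by
  suffices Differentiable ℂ fun s : ℂ => iteratedDeriv k (fun t => base t ^ s) 0 from
    this.div_const _
  induction k using Nat.strong_induction_on with
  | _ k ih =>
    cases k with
    | zero => simp [base_zero]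
    | succ k =>
      simp only [iteratedDeriv_base_cpow_succ]
      refine differentiable_id.mul (Differentiable.fun_sum fun i _ => ?_)
      exact (ih (k - i) (by omega)).const_mul _

theorem logDeriv_base_zero : logDeriv base 0 = 2 / 3 := by
  have h := iteratedDeriv_zero_of_hasSum norm_base_coeff_le (fun _ => hasSum_base) 1
  rw [iteratedDeriv_one] at h
  rw [logDeriv_apply, h, base_zero]
  norm_num

theorem deriv_logDeriv_base_zero : deriv (logDeriv base) 0 = 5 / 9 := by
  have h1 := iteratedDeriv_zero_of_hasSum norm_base_coeff_le (fun _ => hasSum_base) 1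
  have h2 := iteratedDeriv_zero_of_hasSum norm_base_coeff_le (fun _ => hasSum_base) 2
  rw [iteratedDeriv_one] at h1
  rw [iteratedDeriv_succ, iteratedDeriv_one] at h2
  have ha : AnalyticAt ℂ base 0 := analyticAt_base (by simp)
  rw [logDeriv, deriv_div ha.deriv.differentiableAt ha.differentiableAt
    (base_ne_zero (by norm_num)), h1, h2, base_zero]
  norm_num [Nat.factorial]

theorem A_two (s : ℂ) : A 2 s = s * (5 / 18 + 2 / 9 * s) := by
  rw [A, iteratedDeriv_base_cpow_succ]
  simp only [Finset.sum_range_succ, Finset.sum_range_zero, iteratedDeriv_one, iteratedDeriv_zero,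
    iteratedDeriv_base_cpow_succ]
  simp [base_zero, logDeriv_base_zero, deriv_logDeriv_base_zero]
  ring

theorem deriv_A_two_zero : deriv (A 2) 0 = 5 / 18 := by
  rw [funext A_two]
  have h : HasDerivAt (fun s : ℂ => s * (5 / 18 + 2 / 9 * s)) (1 * (5 / 18 + 2 / 9 * 0) +
      0 * (2 / 9 * 1)) 0 :=
    (hasDerivAt_id (0 : ℂ)).mul (((hasDerivAt_id (0 : ℂ)).const_mul (2 / 9)).const_add _)
  rw [h.deriv]
  norm_num

/-! ### The substitution `y = -τ - log (1 - τ)` -/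

/-- The function `-τ - log (1 - τ)` on the real line. -/
noncomputable def logRemainder (τ : ℝ) : ℝ := -τ - Real.log (1 - τ)

theorem logRemainder_zero : logRemainder 0 = 0 := by simp [logRemainder]

theorem hasDerivAt_logRemainder {τ : ℝ} (h : τ < 1) :
    HasDerivAt logRemainder (τ / (1 - τ)) τ := by
  have h1 : 1 - τ ≠ 0 := by linarith
  have := (hasDerivAt_id τ).neg.sub (((hasDerivAt_id τ).const_sub 1).log h1)
  convert! this using 1
  simp only [id]
  field_simp
  ring

theorem strictMonoOn_logRemainder : StrictMonoOn logRemainder (Set.Ico 0 1) := by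
  refine strictMonoOn_of_deriv_pos (convex_Ico 0 1)
    (fun x hx => (hasDerivAt_logRemainder hx.2).continuousAt.continuousWithinAt) fun x hx => ?_
  rw [interior_Ico] at hx
  rw [(hasDerivAt_logRemainder hx.2).deriv]
  exact div_pos hx.1 (by linarith [hx.2])

theorem logRemainder_pos {τ : ℝ} (h0 : 0 < τ) (h1 : τ < 1) : 0 < logRemainder τ := by
  rw [← logRemainder_zero]
  exact strictMonoOn_logRemainder ⟨le_rfl, one_pos⟩ ⟨h0.le, h1⟩ h0

theorem image_logRemainder {δ : ℝ} (h0 : 0 < δ) (h1 : δ < 1) :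
    logRemainder '' Set.Ioo 0 δ = Set.Ioo 0 (logRemainder δ) := by
  apply Set.Subset.antisymm
  · rintro _ ⟨x, hx, rfl⟩
    exact ⟨logRemainder_pos hx.1 (hx.2.trans h1), strictMonoOn_logRemainder
      ⟨hx.1.le, hx.2.trans h1⟩ ⟨h0.le, h1⟩ hx.2⟩
  · have := intermediate_value_Ioo h0.le (f := logRemainder) fun x hx =>
      (hasDerivAt_logRemainder (hx.2.trans_lt h1)).continuousAt.continuousWithinAt
    rwa [logRemainder_zero] at this

theorem injOn_logRemainder {δ : ℝ} (h1 : δ < 1) : Set.InjOn logRemainder (Set.Ioo 0 δ) :=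
  strictMonoOn_logRemainder.injOn.mono
    (Set.Ioo_subset_Ico_self.trans (Set.Ico_subset_Ico_right h1.le))

theorem base_ofReal {τ : ℝ} (h0 : 0 < τ) (h1 : τ < 1) :
    base τ = ((logRemainder τ / (τ ^ 2 / 2) : ℝ) : ℂ) := by
  have : (τ : ℂ) ≠ 0 := by exact_mod_cast h0.ne'
  rw [base, if_neg this, logRemainder]
  push_cast
  rw [Complex.ofReal_log (by linarith)]
  push_cast
  rfl

/-- In `y = τ · τ · (1/2) · base τ` all factors are nonnegative reals, so the complex power splits
without branch corrections. -/
theorem logRemainder_cpow {τ : ℝ} (h0 : 0 < τ) (h1 : τ < 1) (s : ℂ) :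
    (logRemainder τ : ℂ) ^ s = 2 ^ (-s) * (τ : ℂ) ^ (2 * s) * base τ ^ s := by
  have hτ : (τ : ℂ) ≠ 0 := by exact_mod_cast h0.ne'
  have hb : 0 ≤ logRemainder τ / (τ ^ 2 / 2) := (div_pos (logRemainder_pos h0 h1) (by positivity)).le
  have e : logRemainder τ = (τ * τ * 2⁻¹) * (logRemainder τ / (τ ^ 2 / 2)) := by
    field_simp
  have e2 : ((2⁻¹ : ℝ) : ℂ) ^ s = 2 ^ (-s) := by
    rw [Complex.cpow_neg, ← Complex.inv_cpow]
    · push_cast; rfl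
    · rw [show (2 : ℂ) = ((2 : ℝ) : ℂ) by simp, Complex.arg_ofReal_of_nonneg two_pos.le]
      exact Real.pi_pos.ne
  have e3 : (τ : ℂ) ^ (2 * s) = (τ : ℂ) ^ s * (τ : ℂ) ^ s := by
    rw [two_mul, Complex.cpow_add _ _ hτ]
  rw [base_ofReal h0 h1]
  conv_lhs => rw [e]
  rw [Complex.ofReal_mul, Complex.mul_cpow_ofReal_nonneg (by positivity) hb,
    Complex.ofReal_mul, Complex.mul_cpow_ofReal_nonneg (by positivity) (by norm_num), e2,
    Complex.ofReal_mul, Complex.mul_cpow_ofReal_nonneg h0.le h0.le, e3]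
  ring

theorem exp_neg_logRemainder {τ : ℝ} (h1 : τ < 1) :
    Real.exp (-logRemainder τ) = (1 - τ) * Real.exp (1 - (1 - τ)) := by
  rw [logRemainder, neg_sub, sub_neg_eq_add, Real.exp_add, Real.exp_log (by linarith)]
  ring_nf

/-! ### The exponential series with the coefficients of `M` -/

/-- The function `∑_{n ≥ 1} poissonCdf n * exp (-n y)`. -/
noncomputable def expSeries (y : ℝ) : ℝ := cdfGenFun (Real.exp (-y)) - 1

theorem norm_exp_neg_lt_one {y : ℝ} (hy : 0 < y) : ‖Real.exp (-y)‖ < 1 := by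
  rw [Real.norm_of_nonneg (Real.exp_pos _).le, Real.exp_lt_one_iff]
  linarith

theorem hasSum_expSeries {y : ℝ} (hy : 0 < y) :
    HasSum (fun n : ℕ => poissonCdf (n + 1) * Real.exp (-y) ^ (n + 1)) (expSeries y) := by
  have h := hasSum_cdfGenFun (norm_exp_neg_lt_one hy)
  rw [← hasSum_nat_add_iff' 1] at h
  simpa [poissonCdf_zero, expSeries] using h

/-- The closed form at `T = 1 - τ`; the `-1` removes the term `n = 0`. -/
theorem expSeries_logRemainder {τ : ℝ} (h0 : 0 < τ) (h1 : τ < 1) :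
    expSeries (logRemainder τ) = 1 / τ ^ 2 - 1 := by
  rw [expSeries, exp_neg_logRemainder h1, cdfGenFun_mul_exp (by linarith) (by linarith)]
  ring_nf

theorem norm_expSeries_le {y : ℝ} (hy : 0 < y) :
    ‖expSeries y‖ ≤ Real.exp (-y) * (1 - Real.exp (-y))⁻¹ := by
  have hq := norm_exp_neg_lt_one hy
  rw [Real.norm_of_nonneg (Real.exp_pos _).le] at hq
  refine (hasSum_expSeries hy).norm_le_of_bounded
    ((hasSum_geometric_of_lt_one (Real.exp_pos _).le hq).mul_left (Real.exp (-y))) fun n => ?_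
  rw [norm_mul, norm_pow, Real.norm_of_nonneg (Real.exp_pos (-y)).le, ← pow_succ']
  exact mul_le_of_le_one_left (by positivity) (norm_poissonCdf_le_one _)

theorem norm_expSeries_le_inv {y : ℝ} (hy : 0 < y) : ‖expSeries y‖ ≤ y⁻¹ := by
  refine (norm_expSeries_le hy).trans ?_
  have h1 : y + 1 ≤ Real.exp y := Real.add_one_le_exp y
  have e : Real.exp (-y) * (1 - Real.exp (-y))⁻¹ = (Real.exp y - 1)⁻¹ := by
    rw [Real.exp_neg]
    have : Real.exp y - 1 ≠ 0 := by linarith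
    have := (Real.exp_pos y).ne'
    field_simp
  rw [e]
  gcongr
  linarith

theorem isBigO_expSeries_atTop :
    (fun y => (expSeries y : ℂ)) =O[atTop] fun y => Real.exp (-1 * y) := by
  refine Asymptotics.IsBigO.of_bound (1 - Real.exp (-1))⁻¹ ?_
  filter_upwards [eventually_ge_atTop 1] with y hy
  have h1 : Real.exp (-1) < 1 := Real.exp_lt_one_iff.mpr (by norm_num)
  have h2 : Real.exp (-y) ≤ Real.exp (-1) := Real.exp_le_exp.mpr (by linarith)
  rw [Complex.norm_real, neg_one_mul, Real.norm_of_nonneg (Real.exp_pos _).le, mul_comm]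
  refine (norm_expSeries_le (by linarith)).trans ?_
  gcongr

theorem isBigO_expSeries_zero :
    (fun y => (expSeries y : ℂ)) =O[𝓝[>] 0] fun y => y ^ (-1 : ℝ) := by
  refine Asymptotics.IsBigO.of_bound 1 ?_
  filter_upwards [self_mem_nhdsWithin] with y (hy : 0 < y)
  rw [Complex.norm_real, Real.rpow_neg_one, one_mul, Real.norm_of_nonneg (inv_nonneg.mpr hy.le)]
  exact norm_expSeries_le_inv hy

theorem locallyIntegrableOn_expSeries :
    LocallyIntegrableOn (fun y => (expSeries y : ℂ)) (Set.Ioi 0) := by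
  refine ContinuousOn.locallyIntegrableOn (fun y hy => ?_) measurableSet_Ioi
  have h : ContinuousAt expSeries y := by
    refine ContinuousAt.sub (ContinuousAt.comp' ?_ ?_) continuousAt_const
    · exact (analyticAt_cdfGenFun (norm_exp_neg_lt_one hy)).continuousAt
    · fun_prop
  exact (Complex.continuous_ofReal.continuousAt.comp h).continuousWithinAt

/-! ### Mellin transform of the exponential series -/

theorem mellinConvergent_expSeries {s : ℂ} (hs : 1 < s.re) :
    MellinConvergent (fun y => (expSeries y : ℂ)) s :=
  mellinConvergent_of_isBigO_rpow_exp one_pos locallyIntegrableOn_expSeries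
    isBigO_expSeries_atTop isBigO_expSeries_zero hs

/-- The Mellin transform of `expSeries`, cut off near zero. -/
noncomputable def mellinTail (y₀ : ℝ) : ℂ → ℂ :=
  mellin ((Set.Ioi y₀).indicator fun y => (expSeries y : ℂ))

theorem differentiable_mellinTail {y₀ : ℝ} (hy₀ : 0 < y₀) : Differentiable ℂ (mellinTail y₀) := by
  intro s
  -- The function vanishes near zero, so any exponent below `Re s` serves as `b`.
  refine mellin_differentiableAt_of_isBigO_rpow_exp (b := s.re - 1) one_pos (fun x hx => ?_) ?_ ?_
    (by linarith)
  · obtain ⟨U, hU, h⟩ := locallyIntegrableOn_expSeries x hx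
    exact ⟨U, hU, h.indicator measurableSet_Ioi⟩
  · refine isBigO_expSeries_atTop.congr' ?_ EventuallyEq.rfl
    filter_upwards [eventually_gt_atTop y₀] with y hy
    rw [Set.indicator_of_mem (Set.mem_Ioi.mpr hy)]
  · refine Asymptotics.IsBigO.congr' (Asymptotics.isBigO_zero _ _) ?_ EventuallyEq.rfl
    filter_upwards [mem_nhdsWithin_of_mem_nhds (Iio_mem_nhds hy₀)] with y hy
    rw [Set.indicator_of_notMem (by simpa using (Set.mem_Iio.mp hy).le)]

/-- Each `e^{-ny}` has Mellin transform `Γ(s) n^{-s}`; since `p n ≤ 1`, termwise integration is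
justified for `Re s > 1`. -/
theorem hasSum_seriesTerm {s : ℂ} (hs : 1 < s.re) :
    HasSum (fun n : ℕ => seriesTerm s (n + 1))
      ((Complex.Gamma s)⁻¹ * mellin (fun y => (expSeries y : ℂ)) s) := by
  have hs0 : 0 < s.re := by linarith
  have h := hasSum_mellin (a := fun n : ℕ => (poissonCdf (n + 1) : ℂ))
    (p := fun n : ℕ => ((n + 1 : ℕ) : ℝ)) (F := fun y => (expSeries y : ℂ)) (s := s)
    (fun n => Or.inr (by positivity)) hs0 (fun y hy => ?_) ?_
  · have h2 := h.mul_left (Complex.Gamma s)⁻¹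
    refine h2.congr_fun fun n => ?_
    have : Complex.Gamma s ≠ 0 := Complex.Gamma_ne_zero_of_re_pos hs0
    rw [seriesTerm_eq]
    push_cast
    field_simp
  · have h := Complex.hasSum_ofReal.mpr (hasSum_expSeries hy)
    refine h.congr_fun fun n => ?_
    rw [← Real.exp_nat_mul]
    push_cast
    ring_nf
  · have h2 : Summable fun n : ℕ => (((n + 1 : ℕ) : ℝ) ^ s.re)⁻¹ :=
      (summable_nat_add_iff 1).mpr (Real.summable_nat_rpow_inv.mpr hs)
    refine Summable.of_nonneg_of_le (fun n => by positivity) (fun n => ?_) h2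
    rw [Complex.norm_real, div_eq_mul_inv]
    exact mul_le_of_le_one_left (by positivity) (norm_poissonCdf_le_one _)

theorem mellin_expSeries_eq {s : ℂ} (hs : 1 < s.re) {y₀ : ℝ} (hy₀ : 0 < y₀) :
    mellin (fun y => (expSeries y : ℂ)) s =
      (∫ y in Set.Ioo 0 y₀, (y : ℂ) ^ (s - 1) * (expSeries y : ℂ)) + mellinTail y₀ s := by
  have hc : IntegrableOn (fun y : ℝ => (y : ℂ) ^ (s - 1) • (expSeries y : ℂ)) (Set.Ioi 0) :=
    mellinConvergent_expSeries hs
  have h1 : mellinTail y₀ s = ∫ y in Set.Ioi y₀, (y : ℂ) ^ (s - 1) • (expSeries y : ℂ) := by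
    have e : ∀ y : ℝ, (y : ℂ) ^ (s - 1) • (Set.Ioi y₀).indicator (fun y => (expSeries y : ℂ)) y =
        (Set.Ioi y₀).indicator (fun y => (y : ℂ) ^ (s - 1) • (expSeries y : ℂ)) y := by
      intro y
      by_cases hy : y ∈ Set.Ioi y₀ <;> simp [hy]
    rw [mellinTail, mellin, funext e, setIntegral_indicator measurableSet_Ioi,
      Set.inter_eq_right.mpr (Set.Ioi_subset_Ioi hy₀.le)]
  rw [h1, ← integral_Ioc_eq_integral_Ioo, mellin, ← Set.Ioc_union_Ioi_eq_Ioi hy₀.le]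
  exact setIntegral_union (Set.Ioc_disjoint_Ioi le_rfl) measurableSet_Ioi
    (hc.mono_set Set.Ioc_subset_Ioi_self) (hc.mono_set (Set.Ioi_subset_Ioi hy₀.le))

/-! ### Integration by parts -/

theorem ofReal_norm_lt {δ τ : ℝ} (hδ : δ ≤ 1 / 2) (h0 : 0 ≤ τ) (h1 : τ ≤ δ) :
    ‖(τ : ℂ)‖ < 3 / 5 := by
  rw [Complex.norm_real, Real.norm_of_nonneg h0]
  linarith

theorem continuousOn_base_cpow {δ : ℝ} (hδ : δ ≤ 1 / 2) (s : ℂ) :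
    ContinuousOn (fun τ : ℝ => base τ ^ s) (Set.Icc 0 δ) := fun _ hτ =>
  (ContinuousAt.comp' (f := fun τ : ℝ => (τ : ℂ)) (g := fun t => base t ^ s)
    (analyticAt_base_cpow s (ofReal_norm_lt hδ hτ.1 hτ.2)).continuousAt
    Complex.continuous_ofReal.continuousAt).continuousWithinAt

theorem intervalIntegrable_cpow_mul_base {δ : ℝ} (h0 : 0 < δ) (hδ : δ ≤ 1 / 2) {s : ℂ}
    (hs : 1 < s.re) :
    IntervalIntegrable (fun τ : ℝ => (τ : ℂ) ^ (2 * s - 3) * base τ ^ s) volume 0 δ := by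
  refine (intervalIntegral.intervalIntegrable_cpow' ?_).mul_continuousOn ?_
  · simp
    linarith
  · rw [Set.uIcc_of_le h0.le]
    exact continuousOn_base_cpow hδ s

/-- After the substitution, `y^{s-1} dy` is integrated to `y^s/s` and `1/τ² - 1` is differentiated
to `-2/τ³`. This removes the Jacobian `τ/(1 - τ)` and leaves a pure power of `base`, whose Taylor
coefficients are the `A k s`. -/
theorem integral_expSeries_eq {δ : ℝ} (h0 : 0 < δ) (hδ : δ ≤ 1 / 2) {s : ℂ} (hs : 1 < s.re) :
    s * ∫ y in Set.Ioo 0 (logRemainder δ), (y : ℂ) ^ (s - 1) * (expSeries y : ℂ) =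
      (1 / (δ : ℂ) ^ 2 - 1) * (logRemainder δ : ℂ) ^ s +
        2 ^ (1 - s) * ∫ τ in (0 : ℝ)..δ, (τ : ℂ) ^ (2 * s - 3) * base τ ^ s := by
  have h1 : δ < 1 := by linarith
  have hy₀ := logRemainder_pos h0 h1
  have hd : ∀ τ ∈ Set.Ioo 0 δ, HasDerivWithinAt logRemainder (τ / (1 - τ)) (Set.Ioo 0 δ) τ :=
    fun τ hτ => (hasDerivAt_logRemainder (hτ.2.trans h1)).hasDerivWithinAt
  have hint : IntegrableOn (fun y : ℝ => (y : ℂ) ^ (s - 1) * (expSeries y : ℂ))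
      (Set.Ioo 0 (logRemainder δ)) :=
    (mellinConvergent_expSeries hs).mono_set Set.Ioo_subset_Ioi_self
  set P : ℝ → ℂ := fun τ =>
    ((τ / (1 - τ) : ℝ) : ℂ) * ((logRemainder τ : ℂ) ^ (s - 1) * (1 / (τ : ℂ) ^ 2 - 1)) with hP
  have hcongr : ∀ τ ∈ Set.Ioo 0 δ, |τ / (1 - τ)| • ((logRemainder τ : ℂ) ^ (s - 1) *
      (expSeries (logRemainder τ) : ℂ)) = P τ := by
    intro τ hτ
    have : 0 ≤ τ / (1 - τ) := div_nonneg hτ.1.le (by linarith [hτ.2])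
    rw [expSeries_logRemainder hτ.1 (hτ.2.trans h1), abs_of_nonneg this, Complex.real_smul]
    simp only [hP]
    push_cast
    rfl
  have hPint : IntegrableOn P (Set.Ioo 0 δ) := by
    rw [← image_logRemainder h0 h1, integrableOn_image_iff_integrableOn_abs_deriv_smul
      measurableSet_Ioo hd (injOn_logRemainder h1)] at hint
    exact hint.congr_fun hcongr measurableSet_Ioo
  have hPeq : ∫ y in Set.Ioo 0 (logRemainder δ), (y : ℂ) ^ (s - 1) * (expSeries y : ℂ) =
      ∫ τ in (0 : ℝ)..δ, P τ := by
    rw [← image_logRemainder h0 h1, integral_image_eq_integral_abs_deriv_smul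
      measurableSet_Ioo hd (injOn_logRemainder h1), intervalIntegral.integral_of_le h0.le,
      integral_Ioc_eq_integral_Ioo]
    exact setIntegral_congr_fun measurableSet_Ioo hcongr
  have hPint' : IntervalIntegrable P volume 0 δ := by
    rwa [intervalIntegrable_iff_integrableOn_Ioo_of_le h0.le]
  have hQint := intervalIntegrable_cpow_mul_base h0 hδ hs
  set G : ℝ → ℂ := fun τ => (1 / (τ : ℂ) ^ 2 - 1) * (logRemainder τ : ℂ) ^ s with hG
  have hGd : ∀ τ ∈ Set.Ioo 0 δ, HasDerivAt G
      (s * P τ - 2 ^ (1 - s) * ((τ : ℂ) ^ (2 * s - 3) * base τ ^ s)) τ := by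
    intro τ hτ
    have hτ1 : τ < 1 := hτ.2.trans h1
    have hτ0 : (τ : ℂ) ≠ 0 := by exact_mod_cast hτ.1.ne'
    have hg : HasDerivAt (fun τ => (logRemainder τ : ℂ)) ((τ / (1 - τ) : ℝ) : ℂ) τ :=
      (hasDerivAt_logRemainder hτ1).ofReal_comp
    have hgs : HasDerivAt (fun τ => (logRemainder τ : ℂ) ^ s)
        (s * (logRemainder τ : ℂ) ^ (s - 1) * ((τ / (1 - τ) : ℝ) : ℂ)) τ := by
      have hs0 : s ≠ 0 := by rintro rfl; simp at hs; linarith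
      convert! (hasDerivAt_ofReal_cpow_const (logRemainder_pos hτ.1 hτ1).ne' hs0).scomp τ
        (hasDerivAt_logRemainder hτ1) using 1
      rw [Complex.real_smul]
      ring
    have hr : HasDerivAt (fun τ : ℝ => 1 / (τ : ℂ) ^ 2 - 1) (-2 / (τ : ℂ) ^ 3) τ := by
      have h2 : HasDerivAt (fun z : ℂ => 1 / z ^ 2 - 1) (-2 / (τ : ℂ) ^ 3) (τ : ℂ) := by
        convert! (((hasDerivAt_pow 2 (τ : ℂ)).inv (pow_ne_zero 2 hτ0)).sub_const 1) using 1
        · funext z; simp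
        · push_cast
          field_simp
      exact h2.comp_ofReal
    have e2 : (2 : ℂ) ^ (1 - s) = 2 * 2 ^ (-s) := by
      rw [sub_eq_add_neg, Complex.cpow_add _ _ two_ne_zero, Complex.cpow_one]
    have e3 : (τ : ℂ) ^ (2 * s - 3) = (τ : ℂ) ^ (2 * s) / (τ : ℂ) ^ 3 := by
      rw [Complex.cpow_sub _ _ hτ0]
      norm_cast
    convert! hr.mul hgs using 1
    simp only [hP]
    rw [logRemainder_cpow hτ.1 hτ1 s, e2, e3]
    ring
  -- The boundary term at zero is of order `τ^{2s-2}`, which tends to 0 because `Re s > 1`.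
  have hG0 : Tendsto G (𝓝[>] 0) (𝓝 0) := by
    have hc : ContinuousWithinAt (fun τ : ℝ => (1 - (τ : ℂ) ^ 2) * (2 ^ (-s) *
        (τ : ℂ) ^ (2 * s - 2) * base τ ^ s)) (Set.Icc 0 δ) 0 := by
      refine ContinuousWithinAt.mul (by fun_prop) (ContinuousWithinAt.mul
        (continuousWithinAt_const.mul ?_) (continuousOn_base_cpow hδ s 0 ⟨le_rfl, h0.le⟩))
      refine (Complex.continuousAt_ofReal_cpow_const 0 _ (Or.inl ?_)).continuousWithinAt
      simp
      linarith
    have hne : 2 * s - 2 ≠ 0 := by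
      intro h
      have := congrArg Complex.re h
      simp at this
      linarith
    have hc' := hc.tendsto
    simp only [Complex.ofReal_zero, Complex.zero_cpow hne, mul_zero, zero_mul] at hc'
    refine (hc'.mono_left (nhdsWithin_le_of_mem (Icc_mem_nhdsGT h0))).congr' ?_
    filter_upwards [Ioo_mem_nhdsGT h0] with τ hτ
    have hτ0 : (τ : ℂ) ≠ 0 := by exact_mod_cast hτ.1.ne'
    have e3 : (τ : ℂ) ^ (2 * s - 2) = (τ : ℂ) ^ (2 * s) / (τ : ℂ) ^ 2 := by
      rw [Complex.cpow_sub _ _ hτ0]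
      norm_cast
    simp only [hG]
    rw [logRemainder_cpow hτ.1 (hτ.2.trans h1) s, e3]
    field_simp
  have hGδ : Tendsto G (𝓝[<] δ) (𝓝 (G δ)) := by
    have hδ0 : (δ : ℂ) ≠ 0 := by exact_mod_cast h0.ne'
    have : ContinuousAt G δ := by
      refine ContinuousAt.mul ?_ ?_
      · have : (δ : ℂ) ^ 2 ≠ 0 := pow_ne_zero _ hδ0
        fun_prop (disch := assumption)
      · exact ContinuousAt.comp' (f := logRemainder) (g := fun x : ℝ => (x : ℂ) ^ s)
          (Complex.continuousAt_ofReal_cpow_const _ _ (Or.inr hy₀.ne'))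
          (hasDerivAt_logRemainder h1).continuousAt
    exact this.tendsto.mono_left nhdsWithin_le_nhds
  have key := intervalIntegral.integral_eq_sub_of_hasDerivAt_of_tendsto h0 hGd
    ((hPint'.const_mul s).sub (hQint.const_mul _)) hG0 hGδ
  rw [intervalIntegral.integral_sub (hPint'.const_mul s) (hQint.const_mul _),
    intervalIntegral.integral_const_mul, intervalIntegral.integral_const_mul, sub_zero,
    sub_eq_iff_eq_add] at key
  rw [hPeq, key]

theorem integral_cpow_mul_base {s : ℂ} (hs : 1 < s.re) :
    ∫ τ in (0 : ℝ)..(1 / 4), (τ : ℂ) ^ (2 * s - 3) * base τ ^ s =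
      (1 / 4 : ℂ) ^ (2 * s - 2) * ∑' k : ℕ, A k s * (1 / 4) ^ k / (2 * s - 2 + k) := by
  obtain ⟨Λ, -, hΛ⟩ := exists_norm_A_le
  have hre : ∀ k : ℕ, (2 * s - 3 + k).re = 2 * s.re - 3 + k := by intro k; simp
  have key := intervalIntegral.hasSum_integral_of_dominated_convergence (μ := volume)
    (a := 0) (b := 1 / 4) (F := fun (k : ℕ) (τ : ℝ) => A k s * (τ : ℂ) ^ (2 * s - 3 + k))
    (f := fun τ : ℝ => (τ : ℂ) ^ (2 * s - 3) * base τ ^ s)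
    (fun (k : ℕ) (τ : ℝ) => Real.exp (Λ * ‖s‖) * τ ^ (2 * s.re - 3) * (1 / 2) ^ k) ?_ ?_ ?_ ?_ ?_
  · rw [← key.tsum_eq, ← tsum_mul_left]
    refine tsum_congr fun k => ?_
    have hk : (2 * s - 2 + k) ≠ 0 := by
      intro h
      have := congrArg Complex.re h
      simp at this
      linarith [(k.cast_nonneg : (0 : ℝ) ≤ k)]
    rw [intervalIntegral.integral_const_mul, integral_cpow]
    · have e : 2 * s - 3 + k + 1 = 2 * s - 2 + k := by ring
      rw [e, Complex.ofReal_zero, Complex.zero_cpow hk, Complex.ofReal_div, Complex.ofReal_one,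
        Complex.ofReal_ofNat, Complex.cpow_add _ _ (by norm_num), Complex.cpow_natCast]
      ring
    · left
      rw [hre]
      linarith [(k.cast_nonneg : (0 : ℝ) ≤ k)]
  · intro k
    refine (Measurable.const_mul ?_ _).aestronglyMeasurable
    fun_prop
  · intro k
    refine Eventually.of_forall fun τ hτ => ?_
    rw [Set.uIoc_of_le (by norm_num)] at hτ
    have hτ0 := hτ.1
    rw [norm_mul, Complex.norm_cpow_eq_rpow_re_of_pos hτ.1, hre, Real.rpow_add hτ.1,
      Real.rpow_natCast]
    calc ‖A k s‖ * (τ ^ (2 * s.re - 3) * τ ^ k)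
        ≤ (Real.exp (Λ * ‖s‖) * 2 ^ k) * (τ ^ (2 * s.re - 3) * (1 / 4) ^ k) := by
          gcongr
          · exact hΛ k s
          · exact hτ.2
      _ = _ := by
          rw [show (1 / 2 : ℝ) = 2 * (1 / 4) by norm_num, mul_pow]
          ring
  · refine Eventually.of_forall fun τ _ => ?_
    exact (summable_geometric_of_lt_one (by norm_num) (by norm_num)).mul_left _
  · simp only [tsum_mul_left]
    refine (IntervalIntegrable.const_mul ?_ _).mul_const _
    exact intervalIntegral.intervalIntegrable_rpow' (by linarith)
  · refine Eventually.of_forall fun τ hτ => ?_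
    rw [Set.uIoc_of_le (by norm_num)] at hτ
    have hτ0 : (τ : ℂ) ≠ 0 := by exact_mod_cast hτ.1.ne'
    refine ((hasSum_A s (ofReal_norm_lt (by norm_num) hτ.1.le hτ.2)).mul_left _).congr_fun
      fun k => ?_
    rw [Complex.cpow_add _ _ hτ0, Complex.cpow_natCast]
    ring

/-! ### Convergence and analyticity of the series of polar terms -/

theorem isClosed_natCast_image (K : Set ℕ) : IsClosed ((fun k : ℕ => (k : ℂ)) '' K) := by
  have h : Topology.IsClosedEmbedding fun k : ℕ => ((k : ℝ) : ℂ) :=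
    Complex.isometry_ofReal.isClosedEmbedding.comp Nat.isClosedEmbedding_coe_real
  simpa using h.isClosedMap K (isClosed_discrete K)

/-- A set of natural numbers is closed in `ℂ`, so `2 - 2 s₀` lies at positive distance from `K`. One
`r` serves both as radius and as lower bound. -/
theorem exists_le_norm_pole_denom {K : Set ℕ} {s₀ : ℂ} (h : ∀ k ∈ K, 2 * s₀ - 2 + k ≠ 0) :
    ∃ r > 0, ∀ s ∈ Metric.ball s₀ r, ∀ k ∈ K, r ≤ ‖2 * s - 2 + k‖ := by
  have hmem : 2 - 2 * s₀ ∈ ((fun k : ℕ => (k : ℂ)) '' K)ᶜ := by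
    rintro ⟨k, hk, e⟩
    apply h k hk
    simp only at e
    rw [e]; ring
  obtain ⟨ε, hε, hball⟩ := Metric.isOpen_iff.mp (isClosed_natCast_image K).isOpen_compl _ hmem
  refine ⟨ε / 4, by positivity, fun s hs k hk => ?_⟩
  by_contra! hlt
  suffices (k : ℂ) ∈ Metric.ball (2 - 2 * s₀) ε from hball this ⟨k, hk, rfl⟩
  rw [Metric.mem_ball, dist_eq_norm] at hs ⊢
  have e : (k : ℂ) - (2 - 2 * s₀) = (2 * s - 2 + k) - 2 * (s - s₀) := by ring
  rw [e]
  refine (norm_sub_le _ _).trans_lt ?_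
  rw [norm_mul, Complex.norm_ofNat]
  linarith

/-- The `k`-th term of the Mellin transform near zero, with its pole at `1 - k / 2`. -/
noncomputable def poleTerm (k : ℕ) (s : ℂ) : ℂ := A k s * (1 / 4) ^ k / (2 * s - 2 + k)

theorem differentiableAt_poleTerm {k : ℕ} {s : ℂ} (h : 2 * s - 2 + k ≠ 0) :
    DifferentiableAt ℂ (poleTerm k) s :=
  ((differentiable_A k s).mul_const _).div (by fun_prop) h

theorem norm_poleTerm_le {Λ r R : ℝ} (hΛ0 : 0 ≤ Λ)
    (hΛ : ∀ k s, ‖A k s‖ ≤ Real.exp (Λ * ‖s‖) * 2 ^ k) (hr : 0 < r) {s : ℂ} (hs : ‖s‖ ≤ R) {k : ℕ}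
    (hk : r ≤ ‖2 * s - 2 + k‖) :
    ‖poleTerm k s‖ ≤ Real.exp (Λ * R) / r * (1 / 2) ^ k := by
  rw [poleTerm, norm_div, norm_mul, norm_pow]
  calc ‖A k s‖ * ‖(1 / 4 : ℂ)‖ ^ k / ‖2 * s - 2 + k‖
      ≤ (Real.exp (Λ * R) * 2 ^ k) * (1 / 4) ^ k / r := by
        gcongr
        · exact (hΛ k s).trans (by gcongr)
        · simp
    _ = _ := by
        rw [show (1 / 2 : ℝ) = 2 * (1 / 4) by norm_num, mul_pow]
        ring

theorem summable_poleTerm (s : ℂ) : Summable fun k => poleTerm k s := by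
  obtain ⟨Λ, hΛ0, hΛ⟩ := exists_norm_A_le
  obtain ⟨r, hr, h⟩ := exists_le_norm_pole_denom (K := {k | 2 * s - 2 + k ≠ 0}) (s₀ := s)
    fun _ hk => hk
  refine Summable.of_norm_bounded ((summable_geometric_of_lt_one (r := (1 / 2 : ℝ)) (by norm_num)
    (by norm_num)).mul_left (Real.exp (Λ * ‖s‖) / r)) fun k => ?_
  by_cases hk : 2 * s - 2 + k = 0
  -- At a pole, division by zero gives the term the value 0, so the series is summable for every
  -- `s`.
  · rw [poleTerm, hk, div_zero, norm_zero]
    positivity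
  · exact norm_poleTerm_le hΛ0 hΛ hr le_rfl (h s (Metric.mem_ball_self hr) k hk)

/-- Weierstrass' test on a small ball; the indicator allows the one term singular at `s₀` to be left
out. -/
theorem analyticAt_tsum_indicator_poleTerm {K : Set ℕ} {s₀ : ℂ}
    (h : ∀ k ∈ K, 2 * s₀ - 2 + k ≠ 0) :
    AnalyticAt ℂ (fun s => ∑' k, K.indicator (fun k => poleTerm k s) k) s₀ := by
  obtain ⟨Λ, hΛ0, hΛ⟩ := exists_norm_A_le
  obtain ⟨r, hr, hK⟩ := exists_le_norm_pole_denom h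
  have hd : DifferentiableOn ℂ (fun s => ∑' k, K.indicator (fun k => poleTerm k s) k)
      (Metric.ball s₀ r) := by
    refine Complex.differentiableOn_tsum_of_summable_norm
      ((summable_geometric_of_lt_one (r := (1 / 2 : ℝ)) (by norm_num)
        (by norm_num)).mul_left (Real.exp (Λ * (‖s₀‖ + r)) / r)) (fun k s hs => ?_)
      Metric.isOpen_ball fun k s hs => ?_
    · by_cases hk : k ∈ K
      · simp only [Set.indicator_of_mem hk]
        refine (differentiableAt_poleTerm fun h0 => ?_).differentiableWithinAt
        have := hK s hs k hk
        rw [h0, norm_zero] at this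
        linarith
      · simp only [Set.indicator_of_notMem hk]
        exact differentiableWithinAt_const _
    · by_cases hk : k ∈ K
      · rw [Set.indicator_of_mem hk]
        refine norm_poleTerm_le hΛ0 hΛ hr ?_ (hK s hs k hk)
        have := Metric.mem_ball.mp hs
        rw [dist_eq_norm] at this
        have h2 := norm_add_le s₀ (s - s₀)
        rw [add_sub_cancel] at h2
        linarith
      · rw [Set.indicator_of_notMem hk, norm_zero]
        positivity
  exact hd.analyticAt (Metric.ball_mem_nhds s₀ hr)

/-- The part of the Mellin transform of the series which is entire. -/
noncomputable def entirePart (s : ℂ) : ℂ :=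
  -- The factor 15 is `1/δ² - 1` at the cutoff `δ = 1/4`.
  s * mellinTail (logRemainder (1 / 4)) s + 15 * (logRemainder (1 / 4) : ℂ) ^ s

/-- The factor of the polar part. -/
noncomputable def polarFactor (s : ℂ) : ℂ := 2 ^ (1 - s) * (1 / 4) ^ (2 * s - 2)

theorem logRemainder_quarter_pos : 0 < logRemainder (1 / 4) :=
  logRemainder_pos (by norm_num) (by norm_num)

theorem differentiable_entirePart : Differentiable ℂ entirePart := by
  have h : (logRemainder (1 / 4) : ℂ) ≠ 0 := by exact_mod_cast logRemainder_quarter_pos.ne'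
  refine (differentiable_id.mul (differentiable_mellinTail logRemainder_quarter_pos)).add
    (Differentiable.const_mul ?_ _)
  exact fun s => differentiableAt_id.const_cpow (Or.inl h)

theorem differentiable_polarFactor : Differentiable ℂ polarFactor := by
  intro s
  refine DifferentiableAt.mul ?_ ?_
  · exact DifferentiableAt.const_cpow (by fun_prop) (Or.inl two_ne_zero)
  · exact DifferentiableAt.const_cpow (by fun_prop) (Or.inl (by norm_num))

/-- At a pole the powers of the cutoff `1/4` cancel, so residues do not depend on it. -/
theorem polarFactor_mul {k : ℕ} {s : ℂ} (h : 2 * s - 2 + k = 0) :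
    polarFactor s * (1 / 4) ^ k = 2 ^ (1 - s) := by
  rw [polarFactor, mul_assoc, ← Complex.cpow_natCast, ← Complex.cpow_add _ _ (by norm_num), h,
    Complex.cpow_zero, mul_one]

/-! ### The continuation formula -/

/-- The formula continuing `M`, up to removable singularities at `0, -1, -2, ...`. -/
noncomputable def continuationFormula (s : ℂ) : ℂ :=
  (Complex.Gamma (s + 1))⁻¹ * (entirePart s + polarFactor s * ∑' k, poleTerm k s)

theorem hasSum_continuationFormula {s : ℂ} (hs : 1 < s.re) :
    HasSum (fun n : ℕ => seriesTerm s (n + 1)) (continuationFormula s) := by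
  have hs0 : s ≠ 0 := by rintro rfl; simp at hs; linarith
  convert hasSum_seriesTerm hs using 1
  have h1 := mellin_expSeries_eq hs logRemainder_quarter_pos
  have h2 := integral_expSeries_eq (δ := 1 / 4) (by norm_num) (by norm_num) hs
  rw [integral_cpow_mul_base hs] at h2
  -- The factor `s` from the integration by parts is absorbed by `Γ(s + 1) = s Γ(s)`.
  rw [continuationFormula, Complex.Gamma_add_one s hs0, mul_inv, mul_comm s⁻¹, mul_assoc]
  congr 1
  rw [inv_mul_eq_iff_eq_mul₀ hs0, h1, mul_add, h2, entirePart, polarFactor]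
  simp only [poleTerm]
  push_cast
  ring

theorem differentiable_Gamma_add_one_inv :
    Differentiable ℂ fun s : ℂ => (Complex.Gamma (s + 1))⁻¹ :=
  Complex.differentiable_one_div_Gamma.comp (differentiable_id.add_const 1)

theorem analyticAt_continuationFormula {s₀ : ℂ} (h : ∀ k : ℕ, 2 * s₀ - 2 + k ≠ 0) :
    AnalyticAt ℂ continuationFormula s₀ := by
  have h1 := analyticAt_tsum_indicator_poleTerm (K := Set.univ) (s₀ := s₀) fun k _ => h k
  simp only [Set.indicator_univ] at h1
  exact (differentiable_Gamma_add_one_inv.analyticAt s₀).mul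
    ((differentiable_entirePart.analyticAt s₀).add
      ((differentiable_polarFactor.analyticAt s₀).mul h1))

/-- The sum of the `poleTerm`s but for the `k₀`-th one. -/
noncomputable def poleRest (k₀ : ℕ) (s : ℂ) : ℂ :=
  ∑' k, ({k₀}ᶜ : Set ℕ).indicator (fun k => poleTerm k s) k

theorem analyticAt_poleRest {k₀ : ℕ} {s₀ : ℂ} (h : 2 * s₀ - 2 + k₀ = 0) :
    AnalyticAt ℂ (poleRest k₀) s₀ := by
  refine analyticAt_tsum_indicator_poleTerm fun k hk h2 => hk ?_
  have : (k : ℂ) = k₀ := by linear_combination h2 - h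
  exact_mod_cast this

theorem continuationFormula_eq (k₀ : ℕ) (s : ℂ) :
    continuationFormula s = (Complex.Gamma (s + 1))⁻¹ *
      (entirePart s + polarFactor s * (poleTerm k₀ s + poleRest k₀ s)) := by
  rw [continuationFormula, (summable_poleTerm s).tsum_eq_add_tsum_ite k₀, poleRest]
  congr 5
  funext k
  by_cases hk : k = k₀ <;> simp [hk]

theorem poleTerm_eq {k₀ : ℕ} {s₀ : ℂ} (h : 2 * s₀ - 2 + k₀ = 0) (s : ℂ) :
    poleTerm k₀ s = A k₀ s * (1 / 4) ^ k₀ / 2 / (s - s₀) := by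
  rw [poleTerm, show 2 * s - 2 + (k₀ : ℂ) = 2 * (s - s₀) by linear_combination h, div_div]

theorem meromorphicAt_continuationFormula (s₀ : ℂ) : MeromorphicAt continuationFormula s₀ := by
  by_cases h : ∀ k : ℕ, 2 * s₀ - 2 + k ≠ 0
  · exact (analyticAt_continuationFormula h).meromorphicAt
  · push Not at h
    obtain ⟨k, hk⟩ := h
    rw [funext (continuationFormula_eq k)]
    refine (differentiable_Gamma_add_one_inv.analyticAt s₀).meromorphicAt.mul
      ((differentiable_entirePart.analyticAt s₀).meromorphicAt.add
        ((differentiable_polarFactor.analyticAt s₀).meromorphicAt.mul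
          (MeromorphicAt.add ?_ (analyticAt_poleRest hk).meromorphicAt)))
    refine MeromorphicAt.div ?_ ?_
    · exact ((differentiable_A k).mul_const _).analyticAt s₀ |>.meromorphicAt
    · have : Differentiable ℂ fun s : ℂ => 2 * s - 2 + k := by fun_prop
      exact (this.analyticAt s₀).meromorphicAt

/-! ### Values of the reciprocal Gamma function -/

/-- `q (-m)` is the derivative of `1/Γ` at its simple zero `-m`, obtained by iterating `1/Γ(s) =
s/Γ(s + 1)`. -/
theorem exists_Gamma_inv_eq (m : ℕ) : ∃ q : ℂ → ℂ, Differentiable ℂ q ∧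
    (∀ s, (Complex.Gamma s)⁻¹ = (s + m) * q s) ∧ q (-m) = (-1) ^ m * m.factorial := by
  induction m with
  | zero =>
    refine ⟨fun s => (Complex.Gamma (s + 1))⁻¹, differentiable_Gamma_add_one_inv, fun s => ?_, ?_⟩
    · rw [Complex.one_div_Gamma_eq_self_mul_one_div_Gamma_add_one]
      simp
    · simp
  | succ m ih =>
    obtain ⟨q, hd, h1, h2⟩ := ih
    refine ⟨fun s => s * q (s + 1), differentiable_id.mul
      (hd.comp (differentiable_id.add_const 1)), fun s => ?_, ?_⟩
    · rw [Complex.one_div_Gamma_eq_self_mul_one_div_Gamma_add_one, h1]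
      push_cast
      ring
    · have e : -((m + 1 : ℕ) : ℂ) + 1 = -m := by push_cast; ring
      simp only [e, h2]
      rw [Nat.factorial_succ]
      push_cast
      ring

theorem Gamma_three_half_sub_inv (N : ℕ) :
    (Complex.Gamma (1 / 2 - N + 1))⁻¹ = (-1) ^ ((N : ℤ) - 1) *
      ((2 * N).factorial / (2 ^ (2 * N) * N.factorial)) * (2 / (2 * N - 1)) *
        ((Real.sqrt Real.pi : ℝ) : ℂ)⁻¹ := by
  induction N with
  | zero =>
    rw [Nat.cast_zero, sub_zero, Complex.Gamma_add_one _ (by norm_num), Complex.Gamma_one_half_eq,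
      Real.sqrt_eq_rpow, Complex.ofReal_cpow Real.pi_pos.le]
    norm_num [mul_comm]
  | succ N ih =>
    have e : (1 / 2 - ((N + 1 : ℕ) : ℂ) + 1) = 1 / 2 - N := by push_cast; ring
    rw [e, Complex.one_div_Gamma_eq_self_mul_one_div_Gamma_add_one, ih]
    have h1 : (2 * (N : ℂ) - 1) ≠ 0 := by
      rw [sub_ne_zero]; exact_mod_cast (by omega : 2 * N ≠ 1)
    have h2 : (2 * ((N : ℂ) + 1) - 1) ≠ 0 := by
      have : ((2 * N + 1 : ℕ) : ℂ) ≠ 0 := Nat.cast_ne_zero.mpr (by omega)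
      push_cast at this
      convert this using 1
      ring
    have h3 : (N : ℂ) + 1 ≠ 0 := by exact_mod_cast N.succ_ne_zero
    have h4 : (N.factorial : ℂ) ≠ 0 := by exact_mod_cast N.factorial_ne_zero
    -- The exponent is an integer, so that `N = 0` gives the sign `(-1)^{-1} = -1`.
    have e2 : (-1 : ℂ) ^ (((N + 1 : ℕ) : ℤ) - 1) = -(-1) ^ ((N : ℤ) - 1) := by
      rw [show ((N + 1 : ℕ) : ℤ) - 1 = ((N : ℤ) - 1) + 1 by push_cast; ring,
        zpow_add₀ (by norm_num)]
      simp
    rw [e2, show 2 * (N + 1) = 2 * N + 1 + 1 by ring, Nat.factorial_succ, Nat.factorial_succ,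
      Nat.factorial_succ]
    push_cast
    field_simp
    ring

/-! ### Local behaviour -/

/-- The factor `s` of `A 2 s` cancels the pole of the term `k = 2`. The value is `15 + 32 (5/576 -
1/2) = -13/18`. -/
theorem exists_analyticAt_continuationFormula_zero :
    ∃ G : ℂ → ℂ, AnalyticAt ℂ G 0 ∧ continuationFormula =ᶠ[𝓝[≠] 0] G ∧ G 0 = -13 / 18 := by
  have h0 : 2 * (0 : ℂ) - 2 + (2 : ℕ) = 0 := by norm_num
  refine ⟨fun s => (Complex.Gamma (s + 1))⁻¹ * (entirePart s + polarFactor s *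
    ((5 / 18 + 2 / 9 * s) * (1 / 4) ^ 2 / 2 + poleRest 2 s)), ?_, ?_, ?_⟩
  · refine (differentiable_Gamma_add_one_inv.analyticAt 0).mul
      ((differentiable_entirePart.analyticAt 0).add
        ((differentiable_polarFactor.analyticAt 0).mul (AnalyticAt.add ?_ (analyticAt_poleRest h0))))
    fun_prop
  · filter_upwards [self_mem_nhdsWithin] with s hs
    have hs' : s ≠ 0 := hs
    rw [continuationFormula_eq 2, poleTerm_eq h0, A_two, sub_zero]
    congr 4
    field_simp
  -- Only `k = 0` contributes, because `A k 0 = 0` for `k ≥ 1`.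
  · have hr : poleRest 2 0 = -1 / 2 := by
      rw [poleRest, tsum_eq_single 0]
      · simp [poleTerm, A_zero]
        norm_num
      · intro k hk
        obtain ⟨j, rfl⟩ := Nat.exists_eq_succ_of_ne_zero hk
        simp [poleTerm, A_succ_zero]
    have hp : polarFactor 0 = 32 := by
      rw [polarFactor, mul_zero, zero_sub, sub_zero, Complex.cpow_one, Complex.cpow_neg]
      norm_num
    simp only [hr, hp, entirePart]
    norm_num

/-- The simple zero of `1/Γ(s + 1)` at `-N` meets the simple pole of the term `k = 2N + 2`; only the
product of their leading coefficients survives at `-N`. -/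
theorem exists_analyticAt_continuationFormula_neg {N : ℕ} (hN : 0 < N) :
    ∃ G : ℂ → ℂ, AnalyticAt ℂ G (-N) ∧ continuationFormula =ᶠ[𝓝[≠] (-(N : ℂ))] G ∧
      G (-N) = (-1) ^ (N - 1) * 2 ^ N * (N - 1).factorial * A (2 * N + 2) (-N) := by
  obtain ⟨m, rfl⟩ := Nat.exists_eq_succ_of_ne_zero hN.ne'
  obtain ⟨q, hqd, hq, hqm⟩ := exists_Gamma_inv_eq m
  set N := m.succ with hNdef
  have hk : 2 * (-(N : ℂ)) - 2 + (2 * N + 2 : ℕ) = 0 := by push_cast; ring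
  have hqd' : Differentiable ℂ fun s => q (s + 1) := hqd.comp (differentiable_id.add_const 1)
  refine ⟨fun s => q (s + 1) * ((s + N) * (entirePart s + polarFactor s * poleRest (2 * N + 2) s) +
    polarFactor s * (A (2 * N + 2) s * (1 / 4) ^ (2 * N + 2) / 2)), ?_, ?_, ?_⟩
  · refine (hqd'.analyticAt _).mul ((AnalyticAt.mul (by fun_prop)
      ((differentiable_entirePart.analyticAt _).add
        ((differentiable_polarFactor.analyticAt _).mul (analyticAt_poleRest hk)))).add
      ((differentiable_polarFactor.analyticAt _).mul ?_))
    exact (((differentiable_A _).mul_const _).div_const _).analyticAt _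
  · filter_upwards [self_mem_nhdsWithin] with s hs
    have hs' : s + N ≠ 0 := fun h => hs (eq_neg_of_add_eq_zero_left h)
    have hm : s + 1 + m = s + N := by rw [hNdef]; push_cast; ring
    rw [continuationFormula_eq (2 * N + 2), poleTerm_eq hk, sub_neg_eq_add, hq, hm]
    field_simp
    ring
  · have e1 : -(N : ℂ) + 1 = -m := by rw [hNdef]; push_cast; ring
    have e2 : polarFactor (-N) * (A (2 * N + 2) (-N) * (1 / 4) ^ (2 * N + 2) / 2) =
        (polarFactor (-N) * (1 / 4) ^ (2 * N + 2)) * A (2 * N + 2) (-N) / 2 := by ring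
    have e3 : (2 : ℂ) ^ (1 - -(N : ℂ)) = 2 * 2 ^ N := by
      rw [sub_neg_eq_add, Complex.cpow_add _ _ two_ne_zero, Complex.cpow_one, Complex.cpow_natCast]
    simp only [e2]
    rw [polarFactor_mul hk, neg_add_cancel, zero_mul, zero_add, e1, hqm, e3,
      show N - 1 = m from rfl]
    ring

theorem tendsto_continuationFormula_mul {k : ℕ} {s₀ : ℂ} (h : 2 * s₀ - 2 + k = 0) :
    Tendsto (fun s => continuationFormula s * (s - s₀)) (𝓝[≠] s₀)
      (𝓝 ((Complex.Gamma (s₀ + 1))⁻¹ * 2 ^ (1 - s₀) * A k s₀ / 2)) := by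
  have hc : ContinuousAt (fun s => (Complex.Gamma (s + 1))⁻¹ *
      ((entirePart s + polarFactor s * poleRest k s) * (s - s₀) +
        polarFactor s * (A k s * (1 / 4) ^ k / 2))) s₀ := by
    refine (differentiable_Gamma_add_one_inv.continuous.continuousAt).mul
      ((((differentiable_entirePart.continuous.continuousAt).add
        ((differentiable_polarFactor.continuous.continuousAt).mul
          (analyticAt_poleRest h).continuousAt)).mul (by fun_prop)).add
      ((differentiable_polarFactor.continuous.continuousAt).mul ?_))
    exact (((differentiable_A _).mul_const _).div_const _).continuous.continuousAt
  have ht := hc.tendsto.mono_left (nhdsWithin_le_nhds (s := {s₀}ᶜ))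
  have e : polarFactor s₀ * (A k s₀ * (1 / 4) ^ k / 2) =
      (polarFactor s₀ * (1 / 4) ^ k) * A k s₀ / 2 := by ring
  rw [sub_self, mul_zero, zero_add, e, polarFactor_mul h] at ht
  have e2 : (Complex.Gamma (s₀ + 1))⁻¹ * (2 ^ (1 - s₀) * A k s₀ / 2) =
    (Complex.Gamma (s₀ + 1))⁻¹ * 2 ^ (1 - s₀) * A k s₀ / 2 := by ring
  rw [e2] at ht
  refine ht.congr' ?_
  filter_upwards [self_mem_nhdsWithin] with s hs
  have hs' : s - s₀ ≠ 0 := sub_ne_zero.mpr hs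
  rw [continuationFormula_eq k, poleTerm_eq h]
  field_simp
  ring

/-! ### The continuation -/

/-- The continuation of `M`: `continuationFormula` with the removable singularities filled in. -/
noncomputable def continuation (s : ℂ) : ℂ := limUnder (𝓝[≠] s) continuationFormula

theorem continuation_eq_of_eventuallyEq {G : ℂ → ℂ} {s₀ : ℂ} (hG : AnalyticAt ℂ G s₀)
    (h : continuationFormula =ᶠ[𝓝[≠] s₀] G) : continuation s₀ = G s₀ :=
  ((hG.continuousAt.tendsto.mono_left nhdsWithin_le_nhds).congr' h.symm).limUnder_eq

/-- At every point near `s₀` the punctured limit of the formula is the value of `G`, so filling in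
limits yields an analytic function. -/
theorem continuation_eventuallyEq {G : ℂ → ℂ} {s₀ : ℂ} (hG : AnalyticAt ℂ G s₀)
    (h : continuationFormula =ᶠ[𝓝[≠] s₀] G) : continuation =ᶠ[𝓝 s₀] G := by
  have h1 : ∀ᶠ s in 𝓝[≠] s₀, continuation s = G s := by
    filter_upwards [eventually_eventually_nhdsWithin.mpr h, self_mem_nhdsWithin,
      eventually_nhdsWithin_of_eventually_nhds hG.eventually_analyticAt] with s hs hne hGs
    refine continuation_eq_of_eventuallyEq hGs (EventuallyEq.filter_mono ?_ nhdsWithin_le_nhds)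
    rwa [(isOpen_compl_singleton (x := s₀)).nhdsWithin_eq hne] at hs
  filter_upwards [eventually_nhdsWithin_iff.mp h1] with s hs
  rcases eq_or_ne s s₀ with rfl | hne
  · exact continuation_eq_of_eventuallyEq hG h
  · exact hs hne

theorem continuation_eq {s : ℂ} (h : AnalyticAt ℂ continuationFormula s) :
    continuation s = continuationFormula s :=
  continuation_eq_of_eventuallyEq h EventuallyEq.rfl

theorem continuation_eventuallyEq_nhdsNE (s₀ : ℂ) :
    continuation =ᶠ[𝓝[≠] s₀] continuationFormula := by
  filter_upwards [(meromorphicAt_continuationFormula s₀).eventually_analyticAt] with s hs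
  exact continuation_eq hs

/-! ### The singular set, existence and uniqueness of the continuation -/

/-- In terms of the pole index `k = 2 - 2s`, the uncancelled poles are `k = 0` and `k` odd.
Closedness and membership become statements about natural numbers. -/
theorem singularPoints_eq_preimage : singularPoints =
    (fun s : ℂ => 2 - 2 * s) ⁻¹' ((fun k : ℕ => (k : ℂ)) '' {k | k = 0 ∨ Odd k}) := by
  ext s
  simp only [singularPoints, Set.mem_union, Set.mem_singleton_iff, Set.mem_range, Set.mem_preimage,
    Set.mem_image, Set.mem_ofPred_eq]
  constructor
  · rintro (rfl | ⟨N, rfl⟩)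
    · exact ⟨0, Or.inl rfl, by norm_num⟩
    · exact ⟨2 * N + 1, Or.inr ⟨N, rfl⟩, by push_cast; ring⟩
  · rintro ⟨k, rfl | ⟨N, rfl⟩, hk⟩
    · left
      push_cast at hk
      linear_combination (1 / 2) * hk
    · right
      refine ⟨N, ?_⟩
      push_cast at hk
      linear_combination (-1 / 2) * hk

theorem isClosed_singularPoints : IsClosed singularPoints := by
  rw [singularPoints_eq_preimage]
  exact (isClosed_natCast_image _).preimage (by fun_prop)

theorem countable_singularPoints : singularPoints.Countable :=
  (Set.countable_singleton 1).union (Set.countable_range _)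

theorem notMem_singularPoints_of_ne {s : ℂ} (h : ∀ k : ℕ, 2 * s - 2 + k ≠ 0) :
    s ∉ singularPoints := by
  rw [singularPoints_eq_preimage]
  rintro ⟨k, -, hk⟩
  apply h k
  simp only at hk
  rw [hk]
  ring

theorem neg_natCast_notMem_singularPoints (N : ℕ) : -(N : ℂ) ∉ singularPoints := by
  rw [singularPoints_eq_preimage]
  rintro ⟨k, hk, h⟩
  have h' : k = 2 + 2 * N := by
    simp only at h
    have : ((k : ℕ) : ℂ) = ((2 + 2 * N : ℕ) : ℂ) := by
      push_cast
      linear_combination h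
    exact_mod_cast this
  rcases hk with hk | ⟨m, hm⟩ <;> omega

theorem differentiableAt_continuation {s : ℂ} (hs : s ∉ singularPoints) :
    DifferentiableAt ℂ continuation s := by
  have : ∃ G : ℂ → ℂ, AnalyticAt ℂ G s ∧ continuationFormula =ᶠ[𝓝[≠] s] G := by
    by_cases h : ∀ k : ℕ, 2 * s - 2 + k ≠ 0
    · exact ⟨_, analyticAt_continuationFormula h, EventuallyEq.rfl⟩
    · push Not at h
      obtain ⟨k, hk⟩ := h
      rw [singularPoints_eq_preimage] at hs
      have hk2 : k ≠ 0 ∧ ¬ Odd k := by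
        rw [← not_or]
        exact fun h => hs ⟨k, h, by simp only; linear_combination hk⟩
      obtain ⟨N, rfl⟩ : ∃ N, k = 2 * N + 2 := by
        obtain ⟨j, hj⟩ := Nat.not_odd_iff_even.mp hk2.2
        exact ⟨j - 1, by omega⟩
      have hsN : s = -N := by
        push_cast at hk
        linear_combination (1 / 2) * hk
      subst hsN
      rcases Nat.eq_zero_or_pos N with rfl | hN
      · obtain ⟨G, h1, h2, -⟩ := exists_analyticAt_continuationFormula_zero
        simp only [Nat.cast_zero, neg_zero]
        exact ⟨G, h1, h2⟩
      · obtain ⟨G, h1, h2, -⟩ := exists_analyticAt_continuationFormula_neg hN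
        exact ⟨G, h1, h2⟩
  obtain ⟨G, h1, h2⟩ := this
  exact (h1.congr (continuation_eventuallyEq h1 h2).symm).differentiableAt

theorem two_mul_sub_two_add_ne_zero {s : ℂ} (hs : 1 < s.re) (k : ℕ) : 2 * s - 2 + k ≠ 0 := by
  intro h
  have := congrArg Complex.re h
  simp at this
  linarith [(k.cast_nonneg : (0 : ℝ) ≤ k)]

theorem isContinuation_continuation : IsContinuation continuation where
  hasSum s hs := by
    rw [continuation_eq (analyticAt_continuationFormula (two_mul_sub_two_add_ne_zero hs))]
    exact hasSum_continuationFormula hs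
  meromorphic s _ :=
    (meromorphicAt_continuationFormula s).congr (continuation_eventuallyEq_nhdsNE s).symm
  holomorphic _ hs := (differentiableAt_continuation hs).differentiableWithinAt

/-- Removing a countable set from `ℂ`, of real dimension 2, leaves a connected set, so the identity
theorem applies from the half-plane `Re s > 1`. -/
theorem IsContinuation.eqOn {M M' : ℂ → ℂ} (h : IsContinuation M) (h' : IsContinuation M') :
    Set.EqOn M M' singularPointsᶜ := by
  have ho : IsOpen singularPointsᶜ := isClosed_singularPoints.isOpen_compl
  have hre : ∀ s : ℂ, 1 < s.re → M s = M' s := fun s hs => (h.hasSum s hs).unique (h'.hasSum s hs)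
  have h2 : (1 : ℝ) < (2 : ℂ).re := by norm_num
  refine (h.holomorphic.analyticOnNhd ho).eqOn_of_preconnected_of_eventuallyEq
    (h'.holomorphic.analyticOnNhd ho)
    (countable_singularPoints.isPathConnected_compl_of_one_lt_rank ?_).isConnected.isPreconnected
    (z₀ := 2) (notMem_singularPoints_of_ne (two_mul_sub_two_add_ne_zero h2)) ?_
  · rw [Complex.rank_real_complex]
    exact Nat.one_lt_ofNat
  · filter_upwards [(isOpen_lt continuous_const Complex.continuous_re).mem_nhds h2] with s hs
    exact hre s hs

/-- The other pole candidates stay away from `s₀`, so residues of any continuation can be computed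
from the formula. -/
theorem IsContinuation.eventuallyEq {M : ℂ → ℂ} (h : IsContinuation M) {k₀ : ℕ} {s₀ : ℂ}
    (hs₀ : 2 * s₀ - 2 + k₀ = 0) : M =ᶠ[𝓝[≠] s₀] continuationFormula := by
  obtain ⟨r, hr, hk⟩ := exists_le_norm_pole_denom (K := {k₀}ᶜ) (s₀ := s₀) fun k hk h2 => hk (by
    have : (k : ℂ) = k₀ := by linear_combination h2 - hs₀
    exact_mod_cast this)
  filter_upwards [self_mem_nhdsWithin, mem_nhdsWithin_of_mem_nhds (Metric.ball_mem_nhds s₀ hr)]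
    with s hne hs
  have hall : ∀ k : ℕ, 2 * s - 2 + k ≠ 0 := by
    intro k h0
    rcases eq_or_ne k k₀ with rfl | hkk
    · exact hne (show s = s₀ by linear_combination (1 / 2) * (h0 - hs₀))
    · have := hk s hs k hkk
      rw [h0, norm_zero] at this
      linarith
  rw [h.eqOn isContinuation_continuation (notMem_singularPoints_of_ne hall),
    continuation_eq (analyticAt_continuationFormula hall)]

theorem IsContinuation.apply_zero {M : ℂ → ℂ} (h : IsContinuation M) : M 0 = -13 / 18 := by
  have h0 : (0 : ℂ) ∉ singularPoints := by simpa using neg_natCast_notMem_singularPoints 0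
  obtain ⟨G, h1, h2, h3⟩ := exists_analyticAt_continuationFormula_zero
  rw [h.eqOn isContinuation_continuation h0, continuation_eq_of_eventuallyEq h1 h2, h3]

theorem IsContinuation.apply_neg {M : ℂ → ℂ} (h : IsContinuation M) {N : ℕ} (hN : 0 < N) :
    M (-N) = (-1) ^ (N - 1) * 2 ^ N * (N - 1).factorial * A (2 * N + 2) (-N) := by
  obtain ⟨G, h1, h2, h3⟩ := exists_analyticAt_continuationFormula_neg hN
  rw [h.eqOn isContinuation_continuation (neg_natCast_notMem_singularPoints N),
    continuation_eq_of_eventuallyEq h1 h2, h3]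

theorem IsContinuation.tendsto {M : ℂ → ℂ} (h : IsContinuation M) (N : ℕ) :
    Tendsto (fun s : ℂ => M (s + 1 / 2) * (s + N)) (𝓝[≠] (-(N : ℂ)))
      (𝓝 ((-1) ^ ((N : ℤ) - 1) * ((2 * N).factorial / (2 ^ N * N.factorial)) *
        (A (2 * N + 1) (1 / 2 - N) / (2 * N - 1)) * ((Real.sqrt (2 / Real.pi) : ℝ) : ℂ))) := by
  have hk : 2 * (1 / 2 - (N : ℂ)) - 2 + (2 * N + 1 : ℕ) = 0 := by push_cast; ring
  have h1 := (tendsto_continuationFormula_mul hk).congr' ((h.eventuallyEq hk).symm.mul EventuallyEq.rfl)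
  have hsh : Tendsto (fun s : ℂ => s + 1 / 2) (𝓝[≠] (-(N : ℂ))) (𝓝[≠] (1 / 2 - (N : ℂ))) := by
    refine tendsto_nhdsWithin_iff.mpr ⟨?_, ?_⟩
    · have : ContinuousAt (fun s : ℂ => s + 1 / 2) (-(N : ℂ)) := by fun_prop
      convert this.tendsto.mono_left nhdsWithin_le_nhds using 2
      ring
    · filter_upwards [self_mem_nhdsWithin] with s hs h0
      have h0' : s + 1 / 2 = 1 / 2 - N := h0
      exact hs (show s = -N by linear_combination h0')
  convert h1.comp hsh using 2 with s
  · simp only [Function.comp_apply, Pi.mul_apply]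
    ring_nf
  · rw [Gamma_three_half_sub_inv]
    have e : (2 : ℂ) ^ (1 - (1 / 2 - (N : ℂ))) = ((Real.sqrt 2 : ℝ) : ℂ) * 2 ^ N := by
      rw [show (1 - (1 / 2 - (N : ℂ))) = 1 / 2 + N by ring, Complex.cpow_add _ _ two_ne_zero,
        Complex.cpow_natCast, Real.sqrt_eq_rpow, Complex.ofReal_cpow two_pos.le]
      norm_num
    rw [e, Real.sqrt_div two_pos.le]
    push_cast
    rw [pow_mul' (2 : ℂ) 2 N]
    have h4 : (N.factorial : ℂ) ≠ 0 := by exact_mod_cast N.factorial_ne_zero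
    have h5 : (2 : ℂ) ^ N ≠ 0 := pow_ne_zero N two_ne_zero
    field_simp

end BinomialType

theorem theorem1p2 :
    (∃ M : ℂ → ℂ, BinomialType.IsContinuation M) ∧
    ∀ M : ℂ → ℂ, BinomialType.IsContinuation M →
      (M 0 = deriv (BinomialType.A 2) 0 - BinomialType.A 0 0 ∧ M 0 = -13 / 18) ∧
      (∀ N : ℕ, 0 < N →
        M (-(N : ℂ)) =
          (-1 : ℂ) ^ (N - 1) * 2 ^ N * ((N - 1).factorial : ℂ) *
            BinomialType.A (2 * N + 2) (-(N : ℂ))) ∧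
      (∀ N : ℕ,
        Tendsto (fun s : ℂ => M (s + 1 / 2) * (s + (N : ℂ))) (𝓝[≠] (-(N : ℂ)))
          (𝓝 ((-1 : ℂ) ^ ((N : ℤ) - 1) * (((2 * N).factorial : ℂ) / (2 ^ N * (N.factorial : ℂ))) *
            (BinomialType.A (2 * N + 1) (1 / 2 - (N : ℂ)) / (2 * (N : ℂ) - 1)) *
            ((Real.sqrt (2 / Real.pi) : ℝ) : ℂ)))) := by
  refine ⟨⟨_, BinomialType.isContinuation_continuation⟩, fun M hM =>
    ⟨⟨?_, hM.apply_zero⟩, fun N hN => hM.apply_neg hN, hM.tendsto⟩⟩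
  rw [hM.apply_zero, BinomialType.deriv_A_two_zero, BinomialType.A_zero]
  norm_num
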